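/- Let $N,n\ge 1$ be integers and $\mu\in(-1,0)$. Let $A\in\mathbb{R}^{n\times n}$ be the matrix with ones on the superdiagonal and zeros elsewhere, $B=(0,\dots,0,1)^\top\in\mathbb{R}^{n}$, $G_{\mathbf d}=\mathrm{diag}\{1-\mu(n-k)\}_{k=1}^n$ and $\mathbf d(s)=\exp(sG_{\mathbf d})$ for $s\in\mathbb{R}$. Let $X\in\mathbb{R}^{n\times n}$ and $Y\in\mathbb{R}^{1\times n}$ satisfy $$X\succ 0,\qquad G_{\mathbf d}X+XG_{\mathbf d}\succ 0,\qquad AX+XA^\top-BY-Y^\top B^\top\prec 0,$$ and put $K=YX^{-1}$, $P=X^{-1}$, $\|z\|_P=\sqrt{z^\top Pz}$. Let $\|\cdot\|_{\mathbf d}$ be the canonical homogeneous norm: $\|0\|_{\mathbf d}=0$ and, for $z\ne 0$, $\|z\|_{\mathbf d}=e^{s_z}$ with $\|\mathbf d(-s_z)z\|_P=1$. For $e=(e_1,\dots,e_N)$ and $q=(q_1,\dots,q_N)$ in $(\mathbb{R}^n)^N=\mathbb{R}^{Nn}$ let $$f(e,q)=\Bigl(Ae_i-\|e_i\|_{\mathbf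 d}^{1+\mu}\,BK\,\mathbf d(-\ln\|e_i\|_{\mathbf d})\,e_i+q_i\Bigr)_{i=1}^N,$$ where the second term is $0$ if $e_i=0$. (a) The error equation $\dot e=f(e,q)$ is input-to-state stable with respect to $q\in L^\infty(\mathbb{R},\mathbb{R}^{Nn})$: for every $e(0)\in\mathbb{R}^{Nn}$ and every such $q$ there is a Carathéodory solution on $[0,\infty)$, and there are functions $\beta$ of class $\mathscr{KL}$ and $\gamma$ of class $\mathscr K$ such that every Carathéodory solution, with any initial value and any such $q$, satisfies $\|e(t)\|\le\beta(\|e(0)\|,t)+\gamma(\|q\|_{L^\infty})$ for all $t\ge 0$ at which it is defined, where $\|\cdot\|$ is the maximum norm and $\|q\|_{L^\infty}=\mathrm{ess\,sup}_{t>0}\|q(t)\|$. Here $\gamma:\mathbb{R}_{\ge0}\to\mathbb{R}_{\ge0}$ is of class $\mathscr K$ if it is continuous and strictly increasing with $\gamma(0)=0$; $\beta$ is of class $\mathscr{KL}$ if $\beta(\cdot,t)$ is of class $\mathscr K$ for each $t\ge 0$, and $\beta(s,\cdot)$ is continuous and tends to $0$ at infinity for each $s\ge0$ and is strictly decreasing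 for each $s>0$. (b) With $\tilde{\mathbf d}(s)=I_N\otimes\mathbf d(s)$, the maps $D(s):(e,q)\mapsto(\tilde{\mathbf d}(s)e,\,e^{\mu s}\tilde{\mathbf d}(s)q)$ form a dilation of $\mathbb{R}^{2Nn}$ (that is, $D(0)=\mathrm{id}$, $D(a+b)=D(a)D(b)$, and for each $z\neq0$, $\|D(s)z\|\to\infty$ as $s\to+\infty$ and $\|D(s)z\|\to0$ as $s\to-\infty$), and the vector field $f_q(e,q)=(f(e,q),0)$ is homogeneous of degree $\mu$ with respect to it: $f_q(D(s)z)=e^{\mu s}D(s)f_q(z)$ for all $s\in\mathbb{R}$, $z\in\mathbb{R}^{2Nn}$. (c) The equation in (a) is the consensus error equation of the following disturbed closed-loop multi-agent system. Consider a directed graph on the vertices $0,\dots,N$ without self-loops, with weights $w_{ij}=1$ if $j$ transmits to $i$ and $w_{ij}=0$ otherwise, in which the leader $0$ receives nothing and has a directed path to every other vertex. Suppose that $\dot x_i=Ax_i+Bu_i+q_i$, $i=0,\dots,N$, on $[0,\tau]$ with $q_i\in L^\infty(\mathbb{R},\mathbb{R}^n)$, $u_0=0$, $u_i=-\|v_i\|_{\mathbf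 d}^{1+\mu}K\mathbf d(-\ln\|v_i\|_{\mathbf d})v_i$ for $i=1,\dots,N$, where $v_0=0$ and $v_i=\frac{1}{\sum_{j=0}^N w_{ij}}\sum_{j=0}^N w_{ij}(x_i-x_j+v_j)$ for $i=1,\dots,N$. Then $e=(x_1-x_0,\dots,x_N-x_0)$ solves $\dot e=f(e,q)$ on $[0,\tau]$ with $q=(q_1-q_0,\dots,q_N-q_0)$. -/

import Mathlib

open MeasureTheory Filter Topology Matrix
open scoped NNReal ENNReal

noncomputable section

namespace HomConsensus

/-! ### Comparison functions and input-to-state stability -/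

/-- Functions of class `𝒦`: continuous, strictly increasing, vanishing at `0`. -/
structure IsClassK (α : ℝ≥0 → ℝ≥0) : Prop where
  continuous : Continuous α
  strictMono : StrictMono α
  map_zero : α 0 = 0

/-- Functions of class `𝒦ℒ`: class `𝒦` in the first argument; in the second argument continuous,
strictly decreasing and tending to `0`. Since `β 0 t = 0` for every `t`, strict decrease can be
required only for a positive first argument. -/
structure IsClassKL (β : ℝ≥0 → ℝ≥0 → ℝ≥0) : Prop where
  classK : ∀ t, IsClassK fun s => β s t
  continuous : ∀ s, Continuous (β s)
  strictAnti : ∀ s, 0 < s → StrictAnti (β s)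
  tendsto_zero : ∀ s, Tendsto (β s) atTop (𝓝 0)

section ISS

variable {E F : Type*} [NormedAddCommGroup E] [NormedSpace ℝ E] [NormedAddCommGroup F]

/-- `x` is a Carathéodory solution of `ẋ(t) = f(x(t), q(t))` on `[0, τ]`, in integral form (that
is, `x` is absolutely continuous on `[0, τ]` and satisfies the equation almost everywhere). -/
def IsSolutionOn (f : E → F → E) (q : ℝ → F) (x : ℝ → E) (τ : ℝ) : Prop :=
  IntervalIntegrable (fun s => f (x s) (q s)) volume 0 τ ∧
    ∀ t ∈ Set.Icc 0 τ, x t = x 0 + ∫ s in (0 : ℝ)..t, f (x s) (q s)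

/-- The norm `‖q‖_{L^∞} = ess sup_{t > 0} ‖q(t)‖`. -/
def inputNorm (q : ℝ → F) : ℝ≥0 :=
  (eLpNorm q ⊤ (volume.restrict (Set.Ioi 0))).toNNReal

/-- Input-to-state stability of `ẋ = f(x, q)` with respect to `q ∈ L^∞(ℝ, F)`: for every initial
state and every input there is a solution on `[0, ∞)`, and the `𝒦ℒ`-`𝒦` estimate holds, uniformly
over all inputs and initial states, along every solution for as long as it is defined. -/
def IsISS (f : E → F → E) : Prop :=
  (∀ (x₀ : E) (q : ℝ → F), MemLp q ⊤ volume →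
    ∃ x : ℝ → E, x 0 = x₀ ∧ ∀ τ : ℝ, 0 ≤ τ → IsSolutionOn f q x τ) ∧
  ∃ β : ℝ≥0 → ℝ≥0 → ℝ≥0, ∃ γ : ℝ≥0 → ℝ≥0, IsClassKL β ∧ IsClassK γ ∧
    ∀ q : ℝ → F, MemLp q ⊤ volume →
      ∀ (τ : ℝ) (x : ℝ → E), 0 ≤ τ → IsSolutionOn f q x τ →
        ∀ t ∈ Set.Icc 0 τ, ‖x t‖₊ ≤ β ‖x 0‖₊ t.toNNReal + γ (inputNorm q)

/-- A one-parameter group `D` of transformations is a dilation. -/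
structure IsDilation (D : ℝ → E → E) : Prop where
  zero : ∀ x, D 0 x = x
  add : ∀ a b x, D (a + b) x = D a (D b x)
  atTop : ∀ x, x ≠ 0 → Tendsto (fun s => ‖D s x‖) atTop atTop
  atBot : ∀ x, x ≠ 0 → Tendsto (fun s => ‖D s x‖) atBot (𝓝 0)

/-- The vector field `g` is homogeneous of degree `μ` with respect to the dilation `D`. -/
def IsHomogeneousField (D : ℝ → E → E) (μ : ℝ) (g : E → E) : Prop :=
  IsDilation D ∧ ∀ s x, g (D s x) = Real.exp (μ * s) • D s (g x)

end ISS

/-! ### The linear dilation, the homogeneous norm and the closed-loop fields -/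

/-- The chain of integrators: `A` has ones on the superdiagonal, zeros elsewhere. -/
def chainA (n : ℕ) : Matrix (Fin n) (Fin n) ℝ :=
  Matrix.of fun i j => if (i : ℕ) + 1 = j then 1 else 0

/-- The input matrix `B = (0, …, 0, 1)ᵀ`. -/
def chainB (n : ℕ) : Matrix (Fin n) (Fin 1) ℝ :=
  Matrix.of fun i _ => if (i : ℕ) + 1 = n then 1 else 0

/-- The generator `G_d = diag{1 - μ (n - k)}_{k = 1}^n` (the index `k : Fin n` starts at `0`). -/
def generator (n : ℕ) (μ : ℝ) : Matrix (Fin n) (Fin n) ℝ :=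
  Matrix.diagonal fun k => 1 - μ * ((n : ℝ) - ((k : ℕ) + 1))

/-- The linear dilation `d(s) = exp(s G)`. -/
def dil {n : ℕ} (G : Matrix (Fin n) (Fin n) ℝ) (s : ℝ) : Matrix (Fin n) (Fin n) ℝ :=
  NormedSpace.exp (s • G)

/-- The weighted Euclidean norm `‖x‖_P = √(xᵀ P x)`. -/
def weightedNorm {n : ℕ} (P : Matrix (Fin n) (Fin n) ℝ) (x : Fin n → ℝ) : ℝ :=
  Real.sqrt (x ⬝ᵥ (P *ᵥ x))

/-- The canonical homogeneous norm induced by `‖·‖_P` and `d(s) = exp(s G)`: `‖0‖_d = 0` and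
`‖x‖_d = exp(s_x)` for `x ≠ 0`, where `s_x` is such that `‖d(-s_x) x‖_P = 1`. -/
def homNorm {n : ℕ} (G P : Matrix (Fin n) (Fin n) ℝ) (x : Fin n → ℝ) : ℝ :=
  open Classical in
  if x = 0 then 0
  else Real.exp (Classical.epsilon fun s : ℝ => weightedNorm P (dil G (-s) *ᵥ x) = 1)

/-- The homogeneous feedback `v ↦ -‖v‖_d^{1 + μ} K d(-ln ‖v‖_d) v`. -/
def feedback {n : ℕ} (μ : ℝ) (G P : Matrix (Fin n) (Fin n) ℝ) (K : Matrix (Fin 1) (Fin n) ℝ)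
    (v : Fin n → ℝ) : Fin 1 → ℝ :=
  -(homNorm G P v ^ (1 + μ) • (K *ᵥ (dil G (-Real.log (homNorm G P v)) *ᵥ v)))

/-- The perturbed error field on `ℝ^{Nn}`; its `i`-th block is
`A e_i - ‖e_i‖_d^{1 + μ} B K d(-ln ‖e_i‖_d) e_i + q_i`, with `P = X⁻¹` and `K = Y X⁻¹`. -/
def errorField {N n : ℕ} (μ : ℝ) (X : Matrix (Fin n) (Fin n) ℝ) (Y : Matrix (Fin 1) (Fin n) ℝ)
    (e q : Fin N → Fin n → ℝ) : Fin N → Fin n → ℝ :=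
  fun i => chainA n *ᵥ e i +
    chainB n *ᵥ feedback μ (generator n μ) X⁻¹ (Y * X⁻¹) (e i) + q i

/-- The dilation `(e, q) ↦ (d̃(s) e, exp(μ s) d̃(s) q)`, where `d̃(s) = I_N ⊗ d(s)`. -/
def extDil {N n : ℕ} (μ : ℝ) (s : ℝ) (p : (Fin N → Fin n → ℝ) × (Fin N → Fin n → ℝ)) :
    (Fin N → Fin n → ℝ) × (Fin N → Fin n → ℝ) :=
  (fun i => dil (generator n μ) s *ᵥ p.1 i,
    Real.exp (μ * s) • fun i => dil (generator n μ) s *ᵥ p.2 i)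

/-! ### The communication network and the closed-loop multi-agent system -/

/-- A leader-follower communication digraph on the vertices `0, …, N`: `edge i j` means that `j`
transmits to `i`; there are no self-loops; the leader `0` receives nothing and has a directed path
to every follower. -/
structure LeaderGraph (N : ℕ) where
  edge : Fin (N + 1) → Fin (N + 1) → Prop
  loopless : ∀ i, ¬ edge i i
  leader : ∀ j, ¬ edge 0 j
  reachable : ∀ i, i ≠ 0 → Relation.TransGen (fun a b => edge b a) 0 i

/-- The adjacency weights, `1` on edges and `0` elsewhere. -/
def LeaderGraph.weight {N : ℕ} (G : LeaderGraph N) (i j : Fin (N + 1)) : ℝ :=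
  open Classical in if G.edge i j then 1 else 0

/-- The transmitted vectors `v` for the agent states `x`: `v_0 = 0` and
`v_i = (∑_j w_ij)⁻¹ ∑_j w_ij (x_i - x_j + v_j)` for the followers. -/
def IsTransmitted {N n : ℕ} (G : LeaderGraph N) (x v : Fin (N + 1) → Fin n → ℝ) : Prop :=
  v 0 = 0 ∧ ∀ i, i ≠ 0 →
    v i = (1 / ∑ j, G.weight i j) • ∑ j, G.weight i j • (x i - x j + v j)

/-- The agent dynamics `ẋ_i = A x_i + B u_i + q_i`, `i = 0, …, N`, with input `(u, q)`. -/
def agentField {N n : ℕ} (x : Fin (N + 1) → Fin n → ℝ)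
    (p : (Fin (N + 1) → Fin 1 → ℝ) × (Fin (N + 1) → Fin n → ℝ)) : Fin (N + 1) → Fin n → ℝ :=
  fun i => chainA n *ᵥ x i + chainB n *ᵥ p.1 i + p.2 i

/-- `x` is a trajectory on `[0, τ]` of the disturbed multi-agent system under the distributed
protocol: the transmitted vectors `v` solve their algebraic equations, the leader has no control,
and each follower applies the homogeneous feedback to its own `v_i`. -/
def IsClosedLoop {N n : ℕ} (G : LeaderGraph N) (μ : ℝ) (X : Matrix (Fin n) (Fin n) ℝ)
    (Y : Matrix (Fin 1) (Fin n) ℝ) (q : ℝ → Fin (N + 1) → Fin n → ℝ)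
    (x : ℝ → Fin (N + 1) → Fin n → ℝ) (τ : ℝ) : Prop :=
  ∃ (v : ℝ → Fin (N + 1) → Fin n → ℝ) (u : ℝ → Fin (N + 1) → Fin 1 → ℝ),
    (∀ t ∈ Set.Icc 0 τ, IsTransmitted G (x t) (v t) ∧ u t 0 = 0 ∧
      ∀ i, i ≠ 0 → u t i = feedback μ (generator n μ) X⁻¹ (Y * X⁻¹) (v t i)) ∧
    IsSolutionOn agentField (fun t => (u t, q t)) x τ

end HomConsensus

end

/-! The error equation splits into N independent copies of one closed-loop field `loopField` plus an
additive input. With weights `r_k = 1 - μ (n - k)`, this field is homogeneous of degree μ, and the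
matrix inequality makes `zᵀ P (A - BK) z` negative on the unit sphere of `P`. Thus the homogeneous
norm V satisfies V' ≤ -const · V^{1+μ} without input, so V^{-μ} falls at least at a constant rate
away from 0. For stability, V^{-μ} is compared with the explicit level w(t) = W exp(-ct/(1+W)) + θ.
Its slope never exceeds c in size, so a small c lets the dissipation outrun it, and θ is chosen so
large that an input of size δ cannot push a trajectory through the level (`exists_block_estimate`).
Unlike finite-time extinction, this decay is strictly decreasing for all time, as class 𝒦ℒ demands.
Power bounds between V and the usual norm (`exists_homNorm_le`, `exists_norm_le`) turn the estimate
into β and γ. A solution need not be differentiable everywhere, but subtracting the primitive Q of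
the input leaves a path with a right derivative at every time; Q itself enters only through its
Lipschitz constant (`quad_scale_le_one_of_barrier`). Existence is Peano's theorem, the field being
continuous with linear growth (`exists_forward_solution`). Homogeneity follows coordinatewise from
`loopField_scale`. For the network, a discrete maximum principle forces `v_i = x_i - x_0`, and
subtracting the leader's equation gives the error equation. -/

namespace HomConsensus

/-! ### Peano's theorem by delayed equations -/

/-- Pointwise convergence of an equi-Lipschitz family is uniform on compact intervals. -/
theorem tendsto_uniformly_of_equiLipschitz {E : Type*} [NormedAddCommGroup E] {ι : Type*}
    {l : Filter ι} [l.NeBot] {f : ι → ℝ → E} {g : ℝ → E} {T L : ℝ} (hL : 0 ≤ L)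
    (hf : ∀ᶠ k in l, ∀ s ≤ T, ∀ t ≤ T, ‖f k s - f k t‖ ≤ L * |s - t|)
    (hg : ∀ t, Tendsto (fun k => f k t) l (𝓝 (g t))) {ε : ℝ} (hε : 0 < ε) :
    ∀ᶠ k in l, ∀ t ∈ Set.Icc 0 T, ‖f k t - g t‖ < ε := by
  have hgL : ∀ s ≤ T, ∀ t ≤ T, ‖g s - g t‖ ≤ L * |s - t| := fun s hs t ht =>
    le_of_tendsto ((hg s).sub (hg t)).norm (hf.mono fun k hk => hk s hs t ht)
  have hδ : 0 < ε / (3 * (L + 1)) := by positivity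
  obtain ⟨p, hp, hpfin, hcov⟩ := (isCompact_Icc (a := (0 : ℝ)) (b := T)).finite_cover_balls hδ
  have hpt : ∀ᶠ k in l, ∀ a ∈ p, ‖f k a - g a‖ < ε / 3 := by
    rw [hpfin.eventually_all]
    intro a _
    have := (hg a).sub_const (g a)
    rw [sub_self] at this
    have := this.norm
    rw [norm_zero] at this
    exact this.eventually_lt_const (by positivity)
  filter_upwards [hf, hpt] with k hk1 hk2 t ht
  obtain ⟨a, ha, hta⟩ : ∃ a ∈ p, t ∈ Metric.ball a (ε / (3 * (L + 1))) := by
    simpa using hcov ht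
  rw [Metric.mem_ball, Real.dist_eq] at hta
  have h1 := hk1 t ht.2 a (hp ha).2
  have h2 := hgL a (hp ha).2 t ht.2
  rw [abs_sub_comm] at h2
  have h3 := hk2 a ha
  have h4 : L * |t - a| ≤ ε / 3 := by
    calc L * |t - a| ≤ (L + 1) * (ε / (3 * (L + 1))) := by gcongr; linarith
      _ = ε / 3 := by field_simp
  calc ‖f k t - g t‖ = ‖(f k t - f k a) + (f k a - g a) + (g a - g t)‖ := by congr 1; abel
    _ ≤ ‖f k t - f k a‖ + ‖f k a - g a‖ + ‖g a - g t‖ := norm_add₃_le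
    _ < ε := by linarith

section Existence

variable {E : Type*} [NormedAddCommGroup E] [NormedSpace ℝ E]

/-- One step of the delayed Picard iteration for `x t = x₀ + Q t + ∫₀ᵗ Φ (x s) ds`. -/
noncomputable def delayStep (Φ : E → E) (Q : ℝ → E) (x₀ : E) (h : ℝ) (u : ℝ → E) (t : ℝ) : E :=
  x₀ + Q (max t 0) + ∫ s in (0 : ℝ)..max t 0, Φ (u (s - h))

/-- The iterates of `delayStep` starting from the constant function. -/
noncomputable def delayIter (Φ : E → E) (Q : ℝ → E) (x₀ : E) (h : ℝ) : ℕ → ℝ → E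
  | 0 => fun _ => x₀
  | m + 1 => delayStep Φ Q x₀ h (delayIter Φ Q x₀ h m)

variable {Φ : E → E} {Q : ℝ → E} {x₀ : E} {h C : ℝ} {δ : ℝ≥0}

theorem continuous_delayStep (hΦ : Continuous Φ) (hQ : Continuous Q) {u : ℝ → E}
    (hu : Continuous u) : Continuous (delayStep Φ Q x₀ h u) := by
  have h1 : Continuous fun t : ℝ => ∫ s in (0 : ℝ)..t, Φ (u (s - h)) :=
    intervalIntegral.continuous_primitive
      (fun a b => (by fun_prop : Continuous fun s => Φ (u (s - h))).intervalIntegrable a b) 0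
  unfold delayStep
  fun_prop

theorem continuous_delayIter (hΦ : Continuous Φ) (hQ : Continuous Q) (m : ℕ) :
    Continuous (delayIter Φ Q x₀ h m) := by
  induction m with
  | zero => exact continuous_const
  | succ m ih => exact continuous_delayStep hΦ hQ ih

/-- Method of steps. For t ≤ 0 every iterate equals x₀, and the new value at t sees the old iterate
only up to time t - h, so each iteration settles one more interval of length h. There the next
iterate solves the delayed equation exactly. -/
theorem delayIter_stable (hQ0 : Q 0 = 0) (hh : 0 ≤ h) (m : ℕ) :
    ∀ t ≤ m * h, delayIter Φ Q x₀ h (m + 1) t = delayIter Φ Q x₀ h m t := by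
  induction m with
  | zero =>
    intro t ht
    have ht' : max t 0 = 0 := max_eq_right (by simpa using ht)
    simp [delayIter, delayStep, ht', hQ0]
  | succ m ih =>
    intro t ht
    change delayStep Φ Q x₀ h (delayIter Φ Q x₀ h (m + 1)) t
      = delayStep Φ Q x₀ h (delayIter Φ Q x₀ h m) t
    unfold delayStep
    congr 1
    apply intervalIntegral.integral_congr
    intro s hs
    rw [Set.uIcc_of_le (le_max_right t 0)] at hs
    have hm : (0 : ℝ) ≤ m * h := by positivity
    push_cast at ht
    have : s ≤ (m + 1) * h := hs.2.trans (max_le ht (by linarith))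
    simp only [ih (s - h) (by linarith)]

theorem integral_mul_exp_mul (K : ℝ) (T : ℝ) :
    ∫ s in (0 : ℝ)..T, K * Real.exp (K * s) = Real.exp (K * T) - 1 := by
  rw [intervalIntegral.integral_eq_sub_of_hasDerivAt (f := fun s => Real.exp (K * s))]
  · simp
  · intro s _
    have := ((hasDerivAt_id s).const_mul K).exp
    simpa [mul_comm] using this
  · exact Continuous.intervalIntegrable (by fun_prop) _ _

/-- Grönwall's bound by induction on the iterate: a · exp((C+δ)t) reproduces itself under the
integral inequality, since its own integral times C+δ is a · exp((C+δ)t) - a. The bound depends on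
neither m nor h. -/
theorem delayIter_bound (hC : 0 ≤ C) (hgrowth : ∀ x, ‖Φ x‖ ≤ C * (1 + ‖x‖))
    (hQ : LipschitzWith δ Q) (hQ0 : Q 0 = 0) (hh : 0 ≤ h) (m : ℕ) (t : ℝ) :
    1 + ‖delayIter Φ Q x₀ h m t‖ ≤ (1 + ‖x₀‖) * Real.exp ((C + δ) * max t 0) := by
  induction m generalizing t with
  | zero =>
    have : 1 ≤ Real.exp ((C + δ) * max t 0) := Real.one_le_exp (by positivity)
    simp only [delayIter]
    nlinarith [norm_nonneg x₀]
  | succ m ih =>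
    change 1 + ‖delayStep Φ Q x₀ h (delayIter Φ Q x₀ h m) t‖ ≤ _
    unfold delayStep
    set T := max t 0 with hT
    have hT0 : 0 ≤ T := le_max_right _ _
    set a := 1 + ‖x₀‖ with ha
    have ha1 : 1 ≤ a := by rw [ha]; linarith [norm_nonneg x₀]
    have hQT : ‖Q T‖ ≤ ∫ s in (0 : ℝ)..T, (δ : ℝ) * a * Real.exp ((C + δ) * s) := by
      have h1 : ‖Q T‖ ≤ δ * T := by
        have := hQ.dist_le_mul T 0
        rwa [hQ0, dist_zero_right, Real.dist_eq, sub_zero, abs_of_nonneg hT0] at this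
      refine h1.trans ?_
      have h2 : (δ : ℝ) * T = ∫ s in (0 : ℝ)..T, (δ : ℝ) := by simp [mul_comm]
      rw [h2]
      refine intervalIntegral.integral_mono_on hT0 (by simp)
        (Continuous.intervalIntegrable (by fun_prop) _ _) fun s hs => ?_
      have : 1 ≤ Real.exp ((C + δ) * s) :=
        Real.one_le_exp (mul_nonneg (by positivity) hs.1)
      have h3 : 1 ≤ a * Real.exp ((C + δ) * s) := by nlinarith
      have := δ.2
      nlinarith [mul_le_mul_of_nonneg_left h3 δ.2]
    have hint : ‖∫ s in (0 : ℝ)..T, Φ (delayIter Φ Q x₀ h m (s - h))‖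
        ≤ ∫ s in (0 : ℝ)..T, C * a * Real.exp ((C + δ) * s) := by
      refine intervalIntegral.norm_integral_le_of_norm_le hT0 (Eventually.of_forall fun s hs => ?_)
        (Continuous.intervalIntegrable (by fun_prop) _ _)
      refine (hgrowth _).trans ?_
      rw [mul_assoc]
      refine mul_le_mul_of_nonneg_left ((ih _).trans ?_) hC
      have : max (s - h) 0 ≤ s := max_le (by linarith) hs.1.le
      gcongr
    have hsum : (∫ s in (0 : ℝ)..T, (δ : ℝ) * a * Real.exp ((C + δ) * s))
        + ∫ s in (0 : ℝ)..T, C * a * Real.exp ((C + δ) * s)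
        = a * Real.exp ((C + δ) * T) - a := by
      rw [← intervalIntegral.integral_add (Continuous.intervalIntegrable (by fun_prop) _ _)
        (Continuous.intervalIntegrable (by fun_prop) _ _)]
      have : ∀ s : ℝ, (δ : ℝ) * a * Real.exp ((C + δ) * s) + C * a * Real.exp ((C + δ) * s)
          = a * ((C + δ) * Real.exp ((C + δ) * s)) := fun s => by ring
      simp_rw [this]
      rw [intervalIntegral.integral_const_mul, integral_mul_exp_mul]
      ring
    have := norm_add₃_le (a := x₀) (b := Q T)
      (c := ∫ s in (0 : ℝ)..T, Φ (delayIter Φ Q x₀ h m (s - h)))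
    linarith

theorem delayIter_succ_lipschitz (hΦ : Continuous Φ) (hC : 0 ≤ C)
    (hgrowth : ∀ x, ‖Φ x‖ ≤ C * (1 + ‖x‖)) (hQ : LipschitzWith δ Q) (hQ0 : Q 0 = 0) (hh : 0 ≤ h)
    (m : ℕ) {T : ℝ} (hT : 0 ≤ T) {s t : ℝ} (hs : s ≤ T) (ht : t ≤ T) :
    ‖delayIter Φ Q x₀ h (m + 1) s - delayIter Φ Q x₀ h (m + 1) t‖
      ≤ (δ + C * ((1 + ‖x₀‖) * Real.exp ((C + δ) * T))) * |s - t| := by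
  change ‖delayStep Φ Q x₀ h (delayIter Φ Q x₀ h m) s
    - delayStep Φ Q x₀ h (delayIter Φ Q x₀ h m) t‖ ≤ _
  unfold delayStep
  set u := delayIter Φ Q x₀ h m with hu
  have huc : Continuous fun r => Φ (u (r - h)) :=
    hΦ.comp ((continuous_delayIter hΦ hQ.continuous m).comp (by fun_prop))
  have hmax : |max s 0 - max t 0| ≤ |s - t| := abs_max_sub_max_le_abs s t 0
  have h1 : ‖Q (max s 0) - Q (max t 0)‖ ≤ δ * |s - t| := by
    rw [← dist_eq_norm]
    refine (hQ.dist_le_mul _ _).trans ?_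
    rw [Real.dist_eq]
    gcongr
  have h2 : ‖∫ r in (max t 0)..max s 0, Φ (u (r - h))‖
      ≤ C * ((1 + ‖x₀‖) * Real.exp ((C + δ) * T)) * |s - t| := by
    refine (intervalIntegral.norm_integral_le_of_norm_le_const
      (C := C * ((1 + ‖x₀‖) * Real.exp ((C + δ) * T))) fun r hr => ?_).trans ?_
    · refine (hgrowth _).trans (mul_le_mul_of_nonneg_left ?_ hC)
      refine (delayIter_bound hC hgrowth hQ hQ0 hh m _).trans ?_
      have hr2 : r ≤ T := by
        rw [Set.uIoc, Set.mem_Ioc] at hr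
        exact hr.2.trans (max_le (max_le ht hT) (max_le hs hT))
      have : max (r - h) 0 ≤ T := max_le (by linarith) hT
      gcongr
    · gcongr
  have h3 := intervalIntegral.integral_interval_sub_left
    (huc.intervalIntegrable (μ := volume) 0 (max s 0))
    (huc.intervalIntegrable 0 (max t 0))
  calc _ = ‖(Q (max s 0) - Q (max t 0)) + ∫ r in (max t 0)..max s 0, Φ (u (r - h))‖ := by
        rw [← h3]; congr 1; abel
    _ ≤ _ := (norm_add_le _ _).trans (by linarith)

/-- **Peano's theorem**, global form: if `Φ` is continuous with linear growth and `Q` is Lipschitz,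
then `x t = x₀ + Q t + ∫₀ᵗ Φ (x s) ds` has a solution on `[0, ∞)`. -/
theorem exists_forward_solution [FiniteDimensional ℝ E] (hΦ : Continuous Φ) (hC : 0 ≤ C)
    (hgrowth : ∀ x, ‖Φ x‖ ≤ C * (1 + ‖x‖)) (hQ : LipschitzWith δ Q) (hQ0 : Q 0 = 0) (x₀ : E) :
    ∃ x : ℝ → E, (∀ T, ContinuousOn x (Set.Icc 0 T)) ∧
      ∀ t, 0 ≤ t → x t = x₀ + Q t + ∫ s in (0 : ℝ)..t, Φ (x s) := by
  have : ProperSpace E := FiniteDimensional.proper ℝ E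
  set d : ℕ → ℝ := fun k => 1 / ((k : ℝ) + 1) with hd
  have hd0 : ∀ k, 0 ≤ d k := fun k => by positivity
  -- With delay 1/(k+1), the first k(k+1) iterations settle the times up to k; the extra iteration
  -- makes `f k` an image of `delayStep`, hence Lipschitz and a solution of the delayed equation
  -- there.
  set f : ℕ → ℝ → E := fun k => delayIter Φ Q x₀ (d k) (k * (k + 1) + 1) with hf
  have hfc : ∀ k, Continuous (f k) := fun k => continuous_delayIter hΦ hQ.continuous _
  have hfb : ∀ k t, ‖f k t‖ ≤ (1 + ‖x₀‖) * Real.exp ((C + δ) * max t 0) := fun k t => by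
    linarith [delayIter_bound (x₀ := x₀) hC hgrowth hQ hQ0 (hd0 k) (k * (k + 1) + 1) t]
  have hfL : ∀ k T, 0 ≤ T → ∀ s ≤ T, ∀ t ≤ T, ‖f k s - f k t‖
      ≤ (δ + C * ((1 + ‖x₀‖) * Real.exp ((C + δ) * T))) * |s - t| := fun k T hT s hs t ht =>
    delayIter_succ_lipschitz hΦ hC hgrowth hQ hQ0 (hd0 k) _ hT hs ht
  have hfeq : ∀ k : ℕ, ∀ t : ℝ, 0 ≤ t → t ≤ k →
      f k t = x₀ + Q t + ∫ s in (0 : ℝ)..t, Φ (f k (s - d k)) := by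
    intro k t ht htk
    have hmk : ((k * (k + 1) : ℕ) : ℝ) * d k = k := by
      simp only [hd]; push_cast; field_simp
    have hst := delayIter_stable (Φ := Φ) (x₀ := x₀) hQ0 (hd0 k) (k * (k + 1))
    rw [hmk] at hst
    have : f k t = delayStep Φ Q x₀ (d k) (delayIter Φ Q x₀ (d k) (k * (k + 1))) t := rfl
    rw [this, delayStep, max_eq_left ht]
    congr 1
    apply intervalIntegral.integral_congr
    intro s hs
    rw [Set.uIcc_of_le ht] at hs
    simp only [hf]
    rw [hst _ (by linarith [hs.2, hd0 k])]
  -- A free ultrafilter replaces the extraction of a subsequence: boundedness gives a limit at every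
  -- time at once, and the common Lipschitz constant makes the convergence uniform on compact
  -- intervals.
  let U : Ultrafilter ℕ := hyperfilter ℕ
  have hlim : ∀ t, ∃ y, Tendsto (fun k => f k t) U (𝓝 y) := by
    intro t
    obtain ⟨y, _, hy⟩ := (isCompact_closedBall (0 : E)
      ((1 + ‖x₀‖) * Real.exp ((C + δ) * max t 0))).ultrafilter_le_nhds (U.map fun k => f k t)
      (by
        rw [le_principal_iff, Ultrafilter.coe_map, Filter.mem_map]
        exact Eventually.of_forall fun k => by simpa using hfb k t)
    exact ⟨y, hy⟩
  choose x hx using hlim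
  have hUat : (U : Filter ℕ) ≤ atTop := by
    rw [← Nat.cofinite_eq_atTop]; exact hyperfilter_le_cofinite
  have hxL : ∀ T, 0 ≤ T → ∀ s ≤ T, ∀ t ≤ T, ‖x s - x t‖
      ≤ (δ + C * ((1 + ‖x₀‖) * Real.exp ((C + δ) * T))) * |s - t| := fun T hT s hs t ht =>
    le_of_tendsto ((hx s).sub (hx t)).norm (Eventually.of_forall fun k => hfL k T hT s hs t ht)
  have hxc : ∀ T, ContinuousOn x (Set.Icc 0 T) := by
    intro T
    rcases lt_or_ge T 0 with hT | hT
    · simp [Set.Icc_eq_empty (not_le.2 hT)]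
    · refine LipschitzOnWith.continuousOn
        (K := δ + (C * ((1 + ‖x₀‖) * Real.exp ((C + δ) * T))).toNNReal) ?_
      refine LipschitzOnWith.of_dist_le_mul fun s hs t ht => ?_
      rw [dist_eq_norm, Real.dist_eq]
      push_cast
      rw [Real.coe_toNNReal _ (by positivity)]
      exact hxL T hT s hs.2 t ht.2
  refine ⟨x, hxc, fun t ht => ?_⟩
  have hint : Tendsto (fun k => ∫ s in (0 : ℝ)..t, Φ (f k (s - d k))) U
      (𝓝 (∫ s in (0 : ℝ)..t, Φ (x s))) := by
    rw [Metric.tendsto_nhds]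
    intro ε hε
    set R := (1 + ‖x₀‖) * Real.exp ((C + δ) * t) with hR
    set L := δ + C * R with hL
    have hL0 : 0 ≤ L := by positivity
    have huc : UniformContinuousOn Φ (Metric.closedBall 0 R) :=
      (isCompact_closedBall _ _).uniformContinuousOn_of_continuous hΦ.continuousOn
    rw [Metric.uniformContinuousOn_iff] at huc
    obtain ⟨η, hη, hΦη⟩ := huc (ε / (t + 1)) (by positivity)
    have hu := tendsto_uniformly_of_equiLipschitz (l := U) hL0
      (Eventually.of_forall fun k => hfL k t ht) hx (half_pos hη)
    -- Half of η pays for the delay through the Lipschitz constant, the other half for the distance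
    -- from `f k` to the limit.
    have hdt : ∀ᶠ k in (U : Filter ℕ), L * d k < η / 2 := by
      have h1 : Tendsto (fun k => L * d k) atTop (𝓝 (L * 0)) :=
        tendsto_one_div_add_atTop_nhds_zero_nat.const_mul L
      rw [mul_zero] at h1
      exact (h1.mono_left hUat).eventually_lt_const (by positivity)
    filter_upwards [hu, hdt] with k hk1 hk2
    have hfball : ∀ s ≤ t, f k s ∈ Metric.closedBall (0 : E) R := fun s hs => by
      rw [mem_closedBall_zero_iff]
      refine (hfb k s).trans ?_
      have : max s 0 ≤ t := max_le hs ht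
      rw [hR]
      gcongr
    have hxball : ∀ s ≤ t, x s ∈ Metric.closedBall (0 : E) R := fun s hs => by
      refine Metric.isClosed_closedBall.mem_of_tendsto (hx s) (Eventually.of_forall fun k => ?_)
      rw [mem_closedBall_zero_iff]
      refine (hfb k s).trans ?_
      have : max s 0 ≤ t := max_le hs ht
      rw [hR]
      gcongr
    rw [dist_eq_norm, ← intervalIntegral.integral_sub]
    · refine (intervalIntegral.norm_integral_le_of_norm_le_const
        (C := ε / (t + 1)) fun s hs => ?_).trans_lt ?_
      · rw [Set.uIoc_of_le ht] at hs
        rw [← dist_eq_norm]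
        refine (hΦη _ (hfball _ (by linarith [hs.2, hd0 k])) _ (hxball _ hs.2) ?_).le
        rw [dist_eq_norm]
        have h1 := hfL k t ht (s - d k) (by linarith [hs.2, hd0 k]) s hs.2
        have h2 := hk1 s ⟨hs.1.le, hs.2⟩
        rw [show s - d k - s = - d k by ring, abs_neg, abs_of_nonneg (hd0 k)] at h1
        calc ‖f k (s - d k) - x s‖ = ‖(f k (s - d k) - f k s) + (f k s - x s)‖ := by
              congr 1; abel
          _ ≤ ‖f k (s - d k) - f k s‖ + ‖f k s - x s‖ := norm_add_le _ _
          _ < η := by linarith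
      · rw [sub_zero, abs_of_nonneg ht, div_mul_eq_mul_div, div_lt_iff₀ (by positivity)]
        nlinarith
    · exact (hΦ.comp ((hfc k).comp (by fun_prop))).intervalIntegrable _ _
    · refine ContinuousOn.intervalIntegrable ?_
      rw [Set.uIcc_of_le ht]
      exact hΦ.comp_continuousOn (hxc t)
  refine tendsto_nhds_unique (hx t) ((tendsto_const_nhds.add hint).congr' ?_)
  have hev : ∀ᶠ k : ℕ in atTop, t ≤ k := by
    obtain ⟨K, hK⟩ := exists_nat_ge t
    filter_upwards [eventually_ge_atTop K] with k hk
    exact hK.trans (by exact_mod_cast hk)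
  filter_upwards [hUat hev] with k hk
  exact (hfeq k t ht hk).symm

end Existence

/-! ### The network: transmitted vectors and the error equation -/

theorem LeaderGraph.weight_nonneg {N : ℕ} (G : LeaderGraph N) (i j : Fin (N + 1)) :
    0 ≤ G.weight i j := by
  unfold LeaderGraph.weight
  split_ifs <;> norm_num

theorem LeaderGraph.weight_of_edge {N : ℕ} (G : LeaderGraph N) {i j : Fin (N + 1)}
    (h : G.edge i j) : G.weight i j = 1 := by
  simp [LeaderGraph.weight, h]

theorem LeaderGraph.sum_weight_pos {N : ℕ} (G : LeaderGraph N) {i : Fin (N + 1)} (hi : i ≠ 0) :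
    0 < ∑ j, G.weight i j := by
  obtain ⟨j, _, hj⟩ := Relation.TransGen.tail'_iff.1 (G.reachable i hi)
  refine Finset.sum_pos' (fun j _ => G.weight_nonneg i j) ⟨j, Finset.mem_univ _, ?_⟩
  rw [G.weight_of_edge hj]
  exact one_pos

/-- Discrete maximum principle: a function that vanishes at the leader and is averaging at the
followers is nonpositive. -/
theorem LeaderGraph.nonpos_of_averaging {N : ℕ} (G : LeaderGraph N) {w : Fin (N + 1) → ℝ}
    (h0 : w 0 = 0) (h : ∀ i, i ≠ 0 → ∑ j, G.weight i j * (w j - w i) = 0) (i : Fin (N + 1)) :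
    w i ≤ 0 := by
  obtain ⟨m, -, hm⟩ := Finset.exists_max_image Finset.univ w Finset.univ_nonempty
  have hm' : ∀ j, w j ≤ w m := fun j => hm j (Finset.mem_univ _)
  suffices w m ≤ 0 from (hm' i).trans this
  by_cases hm0 : m = 0
  · rw [hm0, h0]
  -- At a maximising follower the averaging sum has only nonpositive terms, so all vanish and every
  -- transmitter to it is a maximiser too. Going backwards along a path reaches the leader.
  have hstep : ∀ a b, G.edge a b → w a = w m → w b = w m := by
    intro a b hab ha
    have ha0 : a ≠ 0 := by
      rintro rfl
      exact G.leader b hab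
    have hsum := h a ha0
    have hle : ∀ j ∈ Finset.univ, G.weight a j * (w j - w a) ≤ 0 := fun j _ =>
      mul_nonpos_of_nonneg_of_nonpos (G.weight_nonneg a j) (by rw [ha]; linarith [hm' j])
    have := (Finset.sum_eq_zero_iff_of_nonpos hle).1 hsum b (Finset.mem_univ _)
    rw [G.weight_of_edge hab, one_mul] at this
    linarith
  have hpath : ∀ a b, Relation.TransGen (fun a b => G.edge b a) a b → w b = w m → w a = w m := by
    intro a b hab
    induction hab with
    | single hab => exact hstep _ _ hab
    | tail _ hbc ih => exact fun hc => ih (hstep _ _ hbc hc)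
  rw [← hpath 0 m (G.reachable m hm0) rfl, h0]

/-- The only transmitted vectors are `v_i = x_i - x_0`. -/
theorem IsTransmitted.eq_sub {N n : ℕ} {G : LeaderGraph N} {x v : Fin (N + 1) → Fin n → ℝ}
    (h : IsTransmitted G x v) (i : Fin (N + 1)) : v i = x i - x 0 := by
  -- The algebraic equation says that the discrepancy v_i - (x_i - x_0) is an average of its
  -- neighbours' values, coordinate by coordinate. The maximum principle applied to it and to its
  -- negative makes it vanish.
  have havg : ∀ k i, i ≠ 0 →
      ∑ j, G.weight i j * ((v j k - (x j k - x 0 k)) - (v i k - (x i k - x 0 k))) = 0 := by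
    intro k i hi
    have hpos := G.sum_weight_pos hi
    have hv := congrFun (h.2 i hi) k
    simp only [Pi.smul_apply, Finset.sum_apply, Pi.add_apply, Pi.sub_apply, smul_eq_mul] at hv
    have hv' : (∑ j, G.weight i j) * v i k = ∑ j, G.weight i j * (x i k - x j k + v j k) := by
      rw [hv]; field_simp
    rw [Finset.sum_mul, ← sub_eq_zero, ← Finset.sum_sub_distrib] at hv'
    rw [← neg_eq_zero, ← hv', ← Finset.sum_neg_distrib]
    exact Finset.sum_congr rfl fun j _ => by ring
  have h0 : ∀ k, v 0 k = 0 := fun k => congrFun h.1 k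
  funext k
  have hle := G.nonpos_of_averaging (w := fun i => v i k - (x i k - x 0 k)) (by simp [h0])
    (havg k) i
  have hge := G.nonpos_of_averaging (w := fun i => -(v i k - (x i k - x 0 k))) (by simp [h0])
    (fun i hi => by
      rw [← neg_eq_zero, ← havg k i hi, ← Finset.sum_neg_distrib]
      exact Finset.sum_congr rfl fun j _ => by ring) i
  simp only [Pi.sub_apply]
  linarith

/-- The map from agent states to consensus errors. -/
noncomputable def errorMap (N n : ℕ) :
    (Fin (N + 1) → Fin n → ℝ) →L[ℝ] (Fin N → Fin n → ℝ) :=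
  ContinuousLinearMap.pi fun i =>
    ContinuousLinearMap.proj (R := ℝ) (φ := fun _ : Fin (N + 1) => Fin n → ℝ) i.succ -
      ContinuousLinearMap.proj (R := ℝ) (φ := fun _ : Fin (N + 1) => Fin n → ℝ) 0

theorem errorMap_apply {N n : ℕ} (x : Fin (N + 1) → Fin n → ℝ) (i : Fin N) :
    errorMap N n x i = x i.succ - x 0 := rfl

theorem IsClosedLoop.isSolutionOn_error {N n : ℕ} {G : LeaderGraph N} {μ : ℝ}
    {X : Matrix (Fin n) (Fin n) ℝ} {Y : Matrix (Fin 1) (Fin n) ℝ}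
    {q x : ℝ → Fin (N + 1) → Fin n → ℝ} {τ : ℝ} (hτ : 0 ≤ τ) (h : IsClosedLoop G μ X Y q x τ) :
    IsSolutionOn (errorField μ X Y) (fun t (i : Fin N) => q t i.succ - q t 0)
      (fun t i => x t i.succ - x t 0) τ := by
  obtain ⟨v, u, hvu, hint, hx⟩ := h
  have heq : ∀ t ∈ Set.Icc 0 τ, errorMap N n (agentField (x t) (u t, q t)) =
      errorField μ X Y (fun i => x t i.succ - x t 0) (fun i => q t i.succ - q t 0) := by
    intro t ht
    obtain ⟨hv, hu0, hu⟩ := hvu t ht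
    funext i
    rw [errorMap_apply]
    simp only [agentField, errorField]
    rw [hu0, hu _ (Fin.succ_ne_zero i), hv.eq_sub, mulVec_zero, mulVec_sub]
    abel
  refine ⟨?_, fun t ht => ?_⟩
  · have h1 : IntervalIntegrable (fun s => errorMap N n (agentField (x s) (u s, q s)))
        volume 0 τ :=
      ⟨(errorMap N n).integrable_comp hint.1, (errorMap N n).integrable_comp hint.2⟩
    refine h1.congr fun s hs => heq s ?_
    rw [Set.uIoc_of_le hτ] at hs
    exact ⟨hs.1.le, hs.2⟩
  · have hint' : IntervalIntegrable (fun s => agentField (x s) (u s, q s)) volume 0 t :=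
      hint.mono_set (by
        rw [Set.uIcc_of_le ht.1, Set.uIcc_of_le hτ]
        exact Set.Icc_subset_Icc_right ht.2)
    have h1 := congrArg (errorMap N n) (hx t ht)
    rw [map_add, ← ContinuousLinearMap.intervalIntegral_comp_comm _ hint'] at h1
    refine h1.trans ?_
    congr 1
    apply intervalIntegral.integral_congr
    intro s hs
    rw [Set.uIcc_of_le ht.1] at hs
    exact heq s ⟨hs.1, hs.2.trans ht.2⟩

/-! ### Quadratic forms -/

section QuadraticForm

variable {n : ℕ} {P : Matrix (Fin n) (Fin n) ℝ}

/-- The quadratic form `z ↦ zᵀ P z`. -/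
def quad (P : Matrix (Fin n) (Fin n) ℝ) (z : Fin n → ℝ) : ℝ := z ⬝ᵥ (P *ᵥ z)

theorem quad_zero : quad P 0 = 0 := by simp [quad]

theorem quad_smul (a : ℝ) (z : Fin n → ℝ) : quad P (a • z) = a ^ 2 * quad P z := by
  simp only [quad, mulVec_smul, dotProduct_smul, smul_dotProduct, smul_eq_mul]
  ring

theorem continuous_quad : Continuous (quad P) := by
  unfold quad
  fun_prop

theorem quad_pos (hP : P.PosDef) {z : Fin n → ℝ} (hz : z ≠ 0) : 0 < quad P z := by
  simpa [quad] using hP.dotProduct_mulVec_pos hz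

theorem dotProduct_mulVec_comm_of_symm (hP : P.IsHermitian) (z w : Fin n → ℝ) :
    w ⬝ᵥ (P *ᵥ z) = z ⬝ᵥ (P *ᵥ w) := by
  have hT : Pᵀ = P := by simpa [conjTranspose_eq_transpose_of_trivial] using hP.eq
  rw [dotProduct_mulVec, ← mulVec_transpose, hT, dotProduct_comm]

theorem quad_add (hP : P.IsHermitian) (z w : Fin n → ℝ) :
    quad P (z + w) = quad P z + 2 * (z ⬝ᵥ (P *ᵥ w)) + quad P w := by
  simp only [quad, mulVec_add, dotProduct_add, add_dotProduct]
  rw [dotProduct_mulVec_comm_of_symm hP z w]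
  ring

theorem hasDerivWithinAt_quad (hP : P.IsHermitian) {z : ℝ → Fin n → ℝ} {z' : Fin n → ℝ}
    {S : Set ℝ} {t : ℝ} (hz : HasDerivWithinAt z z' S t) :
    HasDerivWithinAt (fun t => quad P (z t)) (2 * (z t ⬝ᵥ (P *ᵥ z'))) S t := by
  rw [hasDerivWithinAt_pi] at hz
  have h : HasDerivWithinAt (fun t => ∑ i, z t i * ∑ j, P i j * z t j)
      (∑ i, (z' i * (∑ j, P i j * z t j) + z t i * ∑ j, P i j * z' j)) S t :=
    HasDerivWithinAt.fun_sum fun i _ =>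
      (hz i).mul (HasDerivWithinAt.fun_sum fun j _ => (hz j).const_mul (P i j))
  have heq : 2 * (z t ⬝ᵥ (P *ᵥ z'))
      = ∑ i, (z' i * (∑ j, P i j * z t j) + z t i * ∑ j, P i j * z' j) := by
    rw [two_mul]
    nth_rw 1 [← dotProduct_mulVec_comm_of_symm hP]
    rw [Finset.sum_add_distrib]
    rfl
  rw [heq]
  exact h

/-- A positive continuous function, homogeneous of degree two, dominates the squared norm. -/
theorem exists_mul_norm_sq_le {f : (Fin n → ℝ) → ℝ} (hf : Continuous f)
    (hhom : ∀ (a : ℝ) z, f (a • z) = a ^ 2 * f z) (hpos : ∀ z, z ≠ 0 → 0 < f z) :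
    ∃ c, 0 < c ∧ ∀ z, c * ‖z‖ ^ 2 ≤ f z := by
  obtain ⟨c, hc, hcz⟩ := (isCompact_sphere (0 : Fin n → ℝ) 1).exists_forall_le' hf.continuousOn
    (a := 0) (fun z hz => hpos z (by rintro rfl; simp at hz))
  refine ⟨c, hc, fun z => ?_⟩
  rcases eq_or_ne z 0 with rfl | hz
  · have := hhom 0 0
    simp at this
    simp [this]
  · have hn : 0 < ‖z‖ := norm_pos_iff.2 hz
    have h1 := hcz (‖z‖⁻¹ • z) (by simp [norm_smul, hn.ne'])
    rw [hhom, inv_pow, inv_mul_eq_div, le_div_iff₀ (by positivity)] at h1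
    exact h1

/-- A continuous function, homogeneous of degree two, is dominated by the squared norm. -/
theorem exists_abs_le_mul_norm_sq {f : (Fin n → ℝ) → ℝ} (hf : Continuous f)
    (hhom : ∀ (a : ℝ) z, f (a • z) = a ^ 2 * f z) :
    ∃ c, 0 < c ∧ ∀ z, |f z| ≤ c * ‖z‖ ^ 2 := by
  obtain ⟨c, hc⟩ := (isCompact_sphere (0 : Fin n → ℝ) 1).exists_bound_of_continuousOn
    hf.continuousOn
  refine ⟨max c 1, by positivity, fun z => ?_⟩
  rcases eq_or_ne z 0 with rfl | hz
  · have := hhom 0 0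
    simp at this
    simp [this]
  · have hn : 0 < ‖z‖ := norm_pos_iff.2 hz
    have h1 := (hc (‖z‖⁻¹ • z) (by simp [norm_smul, hn.ne'])).trans (le_max_left c 1)
    rw [hhom, inv_pow, inv_mul_eq_div, Real.norm_eq_abs, abs_div, abs_of_nonneg (sq_nonneg ‖z‖),
      div_le_iff₀ (by positivity)] at h1
    exact h1

theorem exists_norm_sq_le_quad (hP : P.PosDef) : ∃ c, 0 < c ∧ ∀ z, c * ‖z‖ ^ 2 ≤ quad P z :=
  exists_mul_norm_sq_le continuous_quad quad_smul fun _ hz => quad_pos hP hz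

theorem exists_quad_le_norm_sq (P : Matrix (Fin n) (Fin n) ℝ) :
    ∃ c, 0 < c ∧ ∀ z, quad P z ≤ c * ‖z‖ ^ 2 := by
  obtain ⟨c, hc, h⟩ := exists_abs_le_mul_norm_sq (continuous_quad (P := P)) quad_smul
  exact ⟨c, hc, fun z => (le_abs_self _).trans (h z)⟩

end QuadraticForm

/-! ### Diagonal dilations and the canonical homogeneous norm -/

section Scaling

variable {n : ℕ} {r : Fin n → ℝ}

/-- The diagonal dilation with weights `r`. -/
noncomputable def scale (r : Fin n → ℝ) (s : ℝ) (x : Fin n → ℝ) : Fin n → ℝ :=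
  fun k => Real.exp (s * r k) * x k

theorem dil_diagonal_mulVec (r : Fin n → ℝ) (s : ℝ) (x : Fin n → ℝ) :
    dil (diagonal r) s *ᵥ x = scale r s x := by
  funext k
  rw [dil, ← diagonal_smul, exp_diagonal, mulVec_diagonal, Pi.coe_exp, ← Real.exp_eq_exp_ℝ]
  rfl

theorem scale_zero_left (x : Fin n → ℝ) : scale r 0 x = x := by
  funext k; simp [scale]

theorem scale_zero_right (s : ℝ) : scale r s 0 = 0 := by
  funext k; simp [scale]

theorem scale_add (a b : ℝ) (x : Fin n → ℝ) : scale r (a + b) x = scale r a (scale r b x) := by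
  funext k
  simp only [scale]
  rw [add_mul, Real.exp_add, mul_assoc]

theorem scale_add_right (a : ℝ) (x y : Fin n → ℝ) :
    scale r a (x + y) = scale r a x + scale r a y := by
  funext k
  simp only [scale, Pi.add_apply]
  ring

theorem scale_smul (s a : ℝ) (x : Fin n → ℝ) : scale r s (a • x) = a • scale r s x := by
  funext k
  simp only [scale, Pi.smul_apply, smul_eq_mul]
  ring

theorem scale_ne_zero (s : ℝ) {x : Fin n → ℝ} (hx : x ≠ 0) : scale r s x ≠ 0 := by
  intro h
  apply hx
  have := congrArg (scale r (-s)) h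
  rwa [← scale_add, neg_add_cancel, scale_zero_left, scale_zero_right] at this

theorem continuous_scale : Continuous fun p : ℝ × (Fin n → ℝ) => scale r p.1 p.2 := by
  unfold scale
  fun_prop

theorem hasDerivAt_scale (x : Fin n → ℝ) (s : ℝ) :
    HasDerivAt (fun s => scale r s x) (fun k => r k * scale r s x k) s := by
  rw [hasDerivAt_pi]
  intro k
  have := (((hasDerivAt_id s).mul_const (r k)).exp).mul_const (x k)
  refine HasDerivAt.congr_deriv this ?_
  simp only [scale, id]
  ring

end Scaling

/-- Positive definiteness of `P` and of the symmetric part of `P diag(r)`, with weights at least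
one: the data for the canonical homogeneous norm. -/
structure IsHomData {n : ℕ} (r : Fin n → ℝ) (P : Matrix (Fin n) (Fin n) ℝ) : Prop where
  posDef : P.PosDef
  mono : ∀ z, z ≠ 0 → 0 < z ⬝ᵥ (P *ᵥ fun k => r k * z k)
  one_le : ∀ k, 1 ≤ r k

section HomNorm

variable {n : ℕ} {r : Fin n → ℝ} {P : Matrix (Fin n) (Fin n) ℝ}

/-- The derivative in s is -2 zᵀ P diag(r) z at z = d(-s)x, negative by `mono`. This makes the level
s_x unique, so the choice in `homNorm` is harmless. -/
theorem IsHomData.strictAnti (h : IsHomData r P) {x : Fin n → ℝ} (hx : x ≠ 0) :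
    StrictAnti fun s => quad P (scale r (-s) x) := by
  have hd : ∀ s, HasDerivAt (fun s => quad P (scale r (-s) x))
      (2 * (scale r (-s) x ⬝ᵥ (P *ᵥ (-fun k => r k * scale r (-s) x k)))) s := by
    intro s
    rw [← hasDerivWithinAt_univ]
    apply hasDerivWithinAt_quad h.posDef.isHermitian
    rw [hasDerivWithinAt_univ]
    have := (hasDerivAt_scale (r := r) x (-s)).scomp s (hasDerivAt_neg s)
    simpa [Function.comp_def] using this
  apply strictAnti_of_deriv_neg
  intro s
  rw [(hd s).deriv, mulVec_neg, dotProduct_neg]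
  have := h.mono _ (scale_ne_zero (r := r) (-s) hx)
  linarith

theorem continuous_quad_scale : Continuous fun p : ℝ × (Fin n → ℝ) => quad P (scale r (-p.1) p.2) :=
  continuous_quad.comp (continuous_scale.comp
    (by fun_prop : Continuous fun p : ℝ × (Fin n → ℝ) => (-p.1, p.2)))

/-- Intermediate value theorem: positive weights send the form to 0 as s → ∞, and a nonzero
coordinate of x sends it to infinity as s → -∞. -/
theorem IsHomData.exists_eq_one (h : IsHomData r P) {x : Fin n → ℝ} (hx : x ≠ 0) :
    ∃ s, quad P (scale r (-s) x) = 1 := by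
  have hc : Continuous fun s => quad P (scale r (-s) x) :=
    continuous_quad_scale.comp (by fun_prop : Continuous fun s : ℝ => (s, x))
  have hlow : ∃ s, quad P (scale r (-s) x) ≤ 1 := by
    have : Tendsto (fun s => quad P (scale r (-s) x)) atTop (𝓝 (quad P 0)) := by
      refine (continuous_quad.tendsto _).comp ?_
      rw [tendsto_pi_nhds]
      intro k
      have hk : 0 < r k := one_pos.trans_le (h.one_le k)
      have h1 : Tendsto (fun s : ℝ => Real.exp (-s * r k) * x k) atTop (𝓝 (0 * x k)) :=
        (Real.tendsto_exp_atBot.comp (tendsto_neg_atTop_atBot.atBot_mul_const hk)).mul_const _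
      simpa [scale] using h1
    rw [quad_zero] at this
    exact ((this.eventually_lt_const one_pos).exists).imp fun _ hs => hs.le
  have hhigh : ∃ s, 1 ≤ quad P (scale r (-s) x) := by
    obtain ⟨c, hc0, hcz⟩ := exists_norm_sq_le_quad h.posDef
    obtain ⟨k, hk⟩ := Function.ne_iff.1 hx
    have hrk : 0 < r k := one_pos.trans_le (h.one_le k)
    have h1 : Tendsto (fun s : ℝ => c * (Real.exp (-s * r k) * |x k|) ^ 2) atBot atTop := by
      refine Tendsto.const_mul_atTop hc0 ((tendsto_pow_atTop two_ne_zero).comp ?_)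
      exact (Real.tendsto_exp_atTop.comp
        (tendsto_neg_atBot_atTop.atTop_mul_const hrk)).atTop_mul_const (abs_pos.2 hk)
    obtain ⟨s, hs⟩ := (h1.eventually_ge_atTop 1).exists
    refine ⟨s, hs.trans (le_trans ?_ (hcz _))⟩
    have h2 := norm_le_pi_norm (scale r (-s) x) k
    rw [scale, Real.norm_eq_abs, abs_mul, abs_of_pos (Real.exp_pos _)] at h2
    gcongr
  obtain ⟨a, ha⟩ := hlow
  obtain ⟨b, hb⟩ := hhigh
  exact mem_range_of_exists_le_of_exists_ge hc ⟨a, ha⟩ ⟨b, hb⟩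

theorem homNorm_zero (G P : Matrix (Fin n) (Fin n) ℝ) : homNorm G P 0 = 0 := by
  simp [homNorm]

theorem IsHomData.homNorm_spec (h : IsHomData r P) {x : Fin n → ℝ} (hx : x ≠ 0) :
    ∃ s, homNorm (diagonal r) P x = Real.exp s ∧ quad P (scale r (-s) x) = 1 := by
  rw [homNorm, if_neg hx]
  refine ⟨_, rfl, ?_⟩
  have hiff : ∀ s, weightedNorm P (dil (diagonal r) (-s) *ᵥ x) = 1 ↔
      quad P (scale r (-s) x) = 1 := by
    intro s
    rw [weightedNorm, dil_diagonal_mulVec, Real.sqrt_eq_one]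
    rfl
  rw [← hiff]
  apply Classical.epsilon_spec (p := fun s : ℝ => weightedNorm P (dil (diagonal r) (-s) *ᵥ x) = 1)
  obtain ⟨s, hs⟩ := h.exists_eq_one hx
  exact ⟨s, (hiff s).2 hs⟩

theorem IsHomData.homNorm_eq (h : IsHomData r P) {x : Fin n → ℝ} {s : ℝ}
    (hs : quad P (scale r (-s) x) = 1) : homNorm (diagonal r) P x = Real.exp s := by
  have hx : x ≠ 0 := by
    rintro rfl
    rw [scale_zero_right, quad_zero] at hs
    exact zero_ne_one hs
  obtain ⟨s', h1, h2⟩ := h.homNorm_spec hx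
  rw [h1, (h.strictAnti hx).injective (h2.trans hs.symm)]

theorem IsHomData.homNorm_nonneg (h : IsHomData r P) (x : Fin n → ℝ) :
    0 ≤ homNorm (diagonal r) P x := by
  rcases eq_or_ne x 0 with rfl | hx
  · rw [homNorm_zero]
  · obtain ⟨s, hs, -⟩ := h.homNorm_spec hx
    rw [hs]; positivity

theorem IsHomData.homNorm_lt_exp (h : IsHomData r P) {x : Fin n → ℝ} {s : ℝ} :
    homNorm (diagonal r) P x < Real.exp s ↔ quad P (scale r (-s) x) < 1 := by
  rcases eq_or_ne x 0 with rfl | hx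
  · simp [homNorm_zero, scale_zero_right, quad_zero, Real.exp_pos]
  · obtain ⟨s', h1, h2⟩ := h.homNorm_spec hx
    rw [h1, ← h2, Real.exp_lt_exp, (h.strictAnti hx).lt_iff_gt]

theorem IsHomData.exp_lt_homNorm (h : IsHomData r P) {x : Fin n → ℝ} {s : ℝ} :
    Real.exp s < homNorm (diagonal r) P x ↔ 1 < quad P (scale r (-s) x) := by
  rcases eq_or_ne x 0 with rfl | hx
  · simp [homNorm_zero, scale_zero_right, quad_zero, (Real.exp_pos s).not_gt, zero_lt_one.not_gt]
  · obtain ⟨s', h1, h2⟩ := h.homNorm_spec hx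
    rw [h1, ← h2, Real.exp_lt_exp, (h.strictAnti hx).lt_iff_gt]

theorem IsHomData.homNorm_le_exp (h : IsHomData r P) {x : Fin n → ℝ} {s : ℝ} :
    homNorm (diagonal r) P x ≤ Real.exp s ↔ quad P (scale r (-s) x) ≤ 1 := by
  rw [← not_lt, h.exp_lt_homNorm, not_lt]

theorem IsHomData.homNorm_pos (h : IsHomData r P) {x : Fin n → ℝ} (hx : x ≠ 0) :
    0 < homNorm (diagonal r) P x := by
  obtain ⟨s, hs, -⟩ := h.homNorm_spec hx
  rw [hs]; positivity

/-- No implicit function theorem is needed: at a positive level e^s, the strict sublevel and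
superlevel sets are given by strict inequalities for the continuous function x ↦ quad(d(-s)x). -/
theorem IsHomData.continuous_homNorm (h : IsHomData r P) :
    Continuous (homNorm (diagonal r) P) := by
  have hc : ∀ s : ℝ, Continuous fun x => quad P (scale r (-s) x) := fun s =>
    continuous_quad_scale.comp (by fun_prop : Continuous fun x : Fin n → ℝ => (s, x))
  rw [OrderTopology.continuous_iff]
  intro a
  rcases lt_trichotomy a 0 with ha | rfl | ha
  · constructor
    · convert isOpen_univ
      exact Set.eq_univ_of_forall fun x => ha.trans_le (h.homNorm_nonneg x)
    · convert isOpen_empty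
      exact Set.eq_empty_of_forall_notMem fun x hx =>
        absurd (hx.trans ha) (not_lt.2 (h.homNorm_nonneg x))
  · constructor
    · convert (isOpen_compl_singleton (x := (0 : Fin n → ℝ))) using 1
      ext x
      refine ⟨?_, fun hx => h.homNorm_pos hx⟩
      rintro hx rfl
      simp [homNorm_zero] at hx
    · convert isOpen_empty
      exact Set.eq_empty_of_forall_notMem fun x hx => absurd hx (not_lt.2 (h.homNorm_nonneg x))
  · rw [← Real.exp_log ha]
    constructor
    · convert isOpen_lt (continuous_const (y := (1 : ℝ))) (hc (Real.log a)) using 1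
      ext x
      exact h.exp_lt_homNorm
    · convert isOpen_lt (hc (Real.log a)) (continuous_const (y := (1 : ℝ))) using 1
      ext x
      exact h.homNorm_lt_exp

theorem IsHomData.homNorm_scale (h : IsHomData r P) (s : ℝ) (x : Fin n → ℝ) :
    homNorm (diagonal r) P (scale r s x) = Real.exp s * homNorm (diagonal r) P x := by
  rcases eq_or_ne x 0 with rfl | hx
  · rw [scale_zero_right, homNorm_zero, mul_zero]
  · obtain ⟨s', h1, h2⟩ := h.homNorm_spec hx
    rw [h1, ← Real.exp_add]
    apply h.homNorm_eq
    rw [← scale_add, show -(s + s') + s = -s' by ring]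
    exact h2

/-- The projection of `x` to the unit sphere along the dilation is bounded. -/
theorem IsHomData.quad_normalized_le (h : IsHomData r P) (x : Fin n → ℝ) :
    quad P (scale r (-Real.log (homNorm (diagonal r) P x)) x) ≤ 1 := by
  rcases eq_or_ne x 0 with rfl | hx
  · rw [scale_zero_right, quad_zero]; exact zero_le_one
  · obtain ⟨s', h1, h2⟩ := h.homNorm_spec hx
    rw [h1, Real.log_exp, h2]

end HomNorm

/-! ### Weights of the integrator chain and the closed-loop field -/

section ChainWeights

variable {n : ℕ} {μ : ℝ}

/-- The weights `1 - μ (n - k)`, the diagonal of `generator n μ`. -/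
def chainWeight (n : ℕ) (μ : ℝ) (k : Fin n) : ℝ := 1 - μ * ((n : ℝ) - ((k : ℕ) + 1))

theorem generator_eq_diagonal (n : ℕ) (μ : ℝ) : generator n μ = diagonal (chainWeight n μ) := rfl

theorem one_le_chainWeight (hμ : μ ∈ Set.Ioo (-1 : ℝ) 0) (k : Fin n) : 1 ≤ chainWeight n μ k := by
  have h1 : ((k : ℕ) : ℝ) + 1 ≤ n := by exact_mod_cast k.2
  have := hμ.2
  unfold chainWeight
  nlinarith

theorem chainWeight_le (hμ : μ ∈ Set.Ioo (-1 : ℝ) 0) (k : Fin n) :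
    chainWeight n μ k ≤ n + 1 := by
  have h1 : ((k : ℕ) : ℝ) + 1 ≤ n := by exact_mod_cast k.2
  have h2 : (0 : ℝ) ≤ (k : ℕ) := by positivity
  have := hμ.2
  have := hμ.1
  unfold chainWeight
  nlinarith

theorem chainA_mulVec_scale (s : ℝ) (x : Fin n → ℝ) :
    chainA n *ᵥ scale (chainWeight n μ) s x
      = Real.exp (μ * s) • scale (chainWeight n μ) s (chainA n *ᵥ x) := by
  funext i
  simp only [mulVec, dotProduct, Pi.smul_apply, scale, smul_eq_mul, Finset.mul_sum]
  refine Finset.sum_congr rfl fun j _ => ?_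
  simp only [chainA, of_apply]
  split_ifs with hij
  · have : s * chainWeight n μ j = μ * s + s * chainWeight n μ i := by
      simp only [chainWeight, ← hij]
      push_cast
      ring
    rw [this, Real.exp_add]
    ring
  · ring

theorem scale_chainB_mulVec (s : ℝ) (u : Fin 1 → ℝ) :
    scale (chainWeight n μ) s (chainB n *ᵥ u) = Real.exp s • (chainB n *ᵥ u) := by
  funext i
  simp only [mulVec, dotProduct, Pi.smul_apply, scale, smul_eq_mul, chainB, of_apply,
    Finset.univ_unique, Finset.sum_singleton]
  split_ifs with hi
  · have : chainWeight n μ i = 1 := by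
      simp [chainWeight, ← hi]
    rw [this, mul_one]
  · ring

end ChainWeights

section ClosedLoop

variable {n : ℕ} {μ : ℝ} {X : Matrix (Fin n) (Fin n) ℝ} {Y : Matrix (Fin 1) (Fin n) ℝ}

theorem quad_transpose (M : Matrix (Fin n) (Fin n) ℝ) (w : Fin n → ℝ) :
    w ⬝ᵥ (Mᵀ *ᵥ w) = w ⬝ᵥ (M *ᵥ w) := by
  rw [mulVec_transpose, dotProduct_mulVec, dotProduct_comm]

/-- Congruence by X: for z = Xw the form zᵀ X⁻¹ G z equals wᵀ G X w, half the value at w of the form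
of GX + XG. -/
theorem isHomData_chain (hμ : μ ∈ Set.Ioo (-1 : ℝ) 0) (hX : X.PosDef)
    (hGX : (generator n μ * X + X * generator n μ).PosDef) :
    IsHomData (chainWeight n μ) X⁻¹ := by
  refine ⟨hX.inv, fun z hz => ?_, one_le_chainWeight hμ⟩
  have hXu : IsUnit X.det := (isUnit_iff_isUnit_det X).1 hX.isUnit
  have hXw : X *ᵥ (X⁻¹ *ᵥ z) = z := by
    rw [mulVec_mulVec, mul_nonsing_inv _ hXu, one_mulVec]
  have hw : X⁻¹ *ᵥ z ≠ 0 := by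
    intro h
    rw [h, mulVec_zero] at hXw
    exact hz hXw.symm
  have hpos := hGX.dotProduct_mulVec_pos hw
  set w := X⁻¹ *ᵥ z with hwdef
  have hXT : Xᵀ = X := by
    simpa [conjTranspose_eq_transpose_of_trivial] using hX.isHermitian.eq
  have hGT : (generator n μ)ᵀ = generator n μ := diagonal_transpose _
  have hT : X * generator n μ = (generator n μ * X)ᵀ := by rw [transpose_mul, hXT, hGT]
  have hGz : (fun k => chainWeight n μ k * z k) = generator n μ *ᵥ z := by
    funext k
    rw [generator_eq_diagonal, mulVec_diagonal]
  rw [star_trivial, add_mulVec, dotProduct_add, hT, quad_transpose, ← mulVec_mulVec, hXw] at hpos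
  rw [hGz, ← dotProduct_mulVec_comm_of_symm hX.inv.isHermitian, dotProduct_comm]
  linarith

/-- The same congruence: for z = Xw the left side is wᵀ (AX - BY) w, half the form of the matrix
inequality. -/
theorem closedLoop_dissipative (hX : X.PosDef)
    (hLMI : (-(chainA n * X + X * (chainA n)ᵀ - chainB n * Y - Yᵀ * (chainB n)ᵀ)).PosDef)
    {z : Fin n → ℝ} (hz : z ≠ 0) :
    z ⬝ᵥ (X⁻¹ *ᵥ (chainA n *ᵥ z - chainB n *ᵥ ((Y * X⁻¹) *ᵥ z))) < 0 := by
  have hXu : IsUnit X.det := (isUnit_iff_isUnit_det X).1 hX.isUnit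
  have hXw : X *ᵥ (X⁻¹ *ᵥ z) = z := by
    rw [mulVec_mulVec, mul_nonsing_inv _ hXu, one_mulVec]
  have hw : X⁻¹ *ᵥ z ≠ 0 := by
    intro h
    rw [h, mulVec_zero] at hXw
    exact hz hXw.symm
  have hpos := hLMI.dotProduct_mulVec_pos hw
  rw [← mulVec_mulVec (M := Y)]
  set w := X⁻¹ *ᵥ z with hwdef
  have hXT : Xᵀ = X := by
    simpa [conjTranspose_eq_transpose_of_trivial] using hX.isHermitian.eq
  have hM : -(chainA n * X + X * (chainA n)ᵀ - chainB n * Y - Yᵀ * (chainB n)ᵀ)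
      = -((chainA n * X - chainB n * Y) + (chainA n * X - chainB n * Y)ᵀ) := by
    rw [transpose_sub, transpose_mul, transpose_mul, hXT]
    abel
  rw [hM, star_trivial, neg_mulVec, dotProduct_neg, add_mulVec, dotProduct_add, quad_transpose,
    sub_mulVec, ← mulVec_mulVec, hXw, ← mulVec_mulVec] at hpos
  rw [← dotProduct_mulVec_comm_of_symm hX.inv.isHermitian, dotProduct_comm]
  linarith

/-- The undisturbed closed-loop field of one agent. -/
noncomputable def loopField (μ : ℝ) (X : Matrix (Fin n) (Fin n) ℝ) (Y : Matrix (Fin 1) (Fin n) ℝ)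
    (x : Fin n → ℝ) : Fin n → ℝ :=
  chainA n *ᵥ x + chainB n *ᵥ feedback μ (generator n μ) X⁻¹ (Y * X⁻¹) x

theorem errorField_apply {N : ℕ} (e q : Fin N → Fin n → ℝ) (i : Fin N) :
    errorField μ X Y e q i = loopField μ X Y (e i) + q i := rfl

variable (hd : IsHomData (chainWeight n μ) X⁻¹)
include hd

/-- The normalised vector d(-ln V(x)) x is constant along orbits of the dilation, so only the factor
V^{1+μ} changes. -/
theorem feedback_scale (K : Matrix (Fin 1) (Fin n) ℝ) (s : ℝ) (x : Fin n → ℝ) :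
    feedback μ (generator n μ) X⁻¹ K (scale (chainWeight n μ) s x)
      = Real.exp ((1 + μ) * s) • feedback μ (generator n μ) X⁻¹ K x := by
  rcases eq_or_ne x 0 with rfl | hx
  · simp [feedback, scale_zero_right]
  have hpos := hd.homNorm_pos hx
  unfold feedback
  rw [generator_eq_diagonal, hd.homNorm_scale, dil_diagonal_mulVec, dil_diagonal_mulVec,
    ← scale_add, Real.log_mul (Real.exp_pos _).ne' hpos.ne', Real.log_exp,
    Real.mul_rpow (Real.exp_pos _).le hpos.le, ← Real.exp_mul, smul_neg, smul_smul,
    show -(s + Real.log (homNorm (diagonal (chainWeight n μ)) X⁻¹ x)) + s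
      = -Real.log (homNorm (diagonal (chainWeight n μ)) X⁻¹ x) by ring, mul_comm s]

/-- Consecutive weights differ by μ, which gives the drift `A` degree μ. The last weight is 1, so in
the control term the factor e^{(1+μ)s} is e^{μs} times the dilation's own e^s. -/
theorem loopField_scale (s : ℝ) (x : Fin n → ℝ) :
    loopField μ X Y (scale (chainWeight n μ) s x)
      = Real.exp (μ * s) • scale (chainWeight n μ) s (loopField μ X Y x) := by
  unfold loopField
  rw [feedback_scale hd, chainA_mulVec_scale, scale_add_right, scale_chainB_mulVec, mulVec_smul,
    smul_add, smul_smul, ← Real.exp_add]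
  congr 3
  ring_nf

theorem loopField_of_quad_eq_one {z : Fin n → ℝ} (hz : quad X⁻¹ z = 1) :
    loopField μ X Y z = chainA n *ᵥ z - chainB n *ᵥ ((Y * X⁻¹) *ᵥ z) := by
  have h1 : homNorm (generator n μ) X⁻¹ z = 1 := by
    rw [generator_eq_diagonal, hd.homNorm_eq (s := 0), Real.exp_zero]
    rwa [neg_zero, scale_zero_left]
  rw [loopField, feedback, h1, Real.log_one, Real.one_rpow, one_smul, generator_eq_diagonal,
    dil_diagonal_mulVec, neg_zero, scale_zero_left, mulVec_neg, sub_eq_add_neg]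

theorem exists_feedback_bound (K : Matrix (Fin 1) (Fin n) ℝ) :
    ∃ C, 0 < C ∧ ∀ x, ‖feedback μ (generator n μ) X⁻¹ K x‖
      ≤ C * homNorm (generator n μ) X⁻¹ x ^ (1 + μ) := by
  obtain ⟨c, hc, hcz⟩ := exists_norm_sq_le_quad hd.posDef
  have hKc : Continuous fun z => ‖K *ᵥ z‖ := by fun_prop
  obtain ⟨C, hC⟩ := (isCompact_closedBall (0 : Fin n → ℝ) (√(1 / c))).exists_bound_of_continuousOn
    (hKc.continuousOn)
  refine ⟨max C 1, by positivity, fun x => ?_⟩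
  unfold feedback
  rw [generator_eq_diagonal, norm_neg, norm_smul, Real.norm_eq_abs,
    abs_of_nonneg (Real.rpow_nonneg (hd.homNorm_nonneg x) _), mul_comm, dil_diagonal_mulVec]
  refine mul_le_mul_of_nonneg_right ?_ (Real.rpow_nonneg (hd.homNorm_nonneg x) _)
  refine le_trans ?_ (le_max_left C 1)
  have := hC (scale (chainWeight n μ)
    (-Real.log (homNorm (diagonal (chainWeight n μ)) X⁻¹ x)) x) ?_
  · simpa using this
  · rw [mem_closedBall_zero_iff]
    apply Real.le_sqrt_of_sq_le
    rw [le_div_iff₀ hc, mul_comm]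
    exact (hcz _).trans (hd.quad_normalized_le x)

/-- Away from 0 this is composition. At 0 the normalised vector has no limit but stays bounded, and
V^{1+μ} tends to 0 because 1 + μ > 0. -/
theorem continuous_feedback (hμ : μ ∈ Set.Ioo (-1 : ℝ) 0) (K : Matrix (Fin 1) (Fin n) ℝ) :
    Continuous (feedback μ (generator n μ) X⁻¹ K) := by
  have hV : Continuous (homNorm (generator n μ) X⁻¹) := hd.continuous_homNorm
  have hμ1 : 0 < 1 + μ := by linarith [hμ.1]
  rw [continuous_iff_continuousAt]
  intro x
  rcases eq_or_ne x 0 with rfl | hx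
  · obtain ⟨C, hC, hb⟩ := exists_feedback_bound hd K
    have h0 : feedback μ (generator n μ) X⁻¹ K 0 = 0 := by simp [feedback]
    rw [ContinuousAt, h0]
    refine squeeze_zero_norm hb ?_
    have h1 : Continuous fun x => C * homNorm (generator n μ) X⁻¹ x ^ (1 + μ) :=
      continuous_const.mul (hV.rpow_const fun _ => Or.inr hμ1.le)
    have h2 := h1.tendsto 0
    rwa [homNorm_zero, Real.zero_rpow hμ1.ne', mul_zero] at h2
  · have hpos : homNorm (generator n μ) X⁻¹ x ≠ 0 := (hd.homNorm_pos hx).ne'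
    have hlog : ContinuousAt (fun x => Real.log (homNorm (generator n μ) X⁻¹ x)) x :=
      (hV.continuousAt).log hpos
    have hz : ContinuousAt (fun x => scale (chainWeight n μ)
        (-Real.log (homNorm (generator n μ) X⁻¹ x)) x) x :=
      (continuous_scale (r := chainWeight n μ)).continuousAt.comp
        (f := fun x => (-Real.log (homNorm (generator n μ) X⁻¹ x), x))
        (hlog.neg.prodMk continuousAt_id)
    have hK : Continuous fun z => K *ᵥ z := by fun_prop
    have := ((hV.continuousAt (x := x)).rpow_const (p := 1 + μ) (Or.inr hμ1.le)).smul
      (hK.continuousAt.comp hz)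
    refine this.neg.congr (Eventually.of_forall fun y => ?_)
    simp only [feedback, generator_eq_diagonal, dil_diagonal_mulVec]
    rfl

theorem continuous_loopField (hμ : μ ∈ Set.Ioo (-1 : ℝ) 0) : Continuous (loopField μ X Y) := by
  have := continuous_feedback hd hμ (Y * X⁻¹)
  unfold loopField
  fun_prop

end ClosedLoop

/-! ### Comparison of the homogeneous norm with the usual norm -/

section Powers

theorem rpow_le_one_add {x a : ℝ} (hx : 0 ≤ x) (ha : 0 ≤ a) (ha1 : a ≤ 1) : x ^ a ≤ 1 + x := by
  rcases le_total x 1 with h | h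
  · linarith [Real.rpow_le_one hx h ha]
  · have := Real.rpow_le_rpow_of_exponent_le h ha1
    rw [Real.rpow_one] at this
    linarith

/-- The least favourable exponent in [p, R] is p when L ≥ 1 and R when L ≤ 1; a sum of two roots
covers both cases, and unlike a maximum it is visibly of class 𝒦 in m. -/
theorem le_rpow_of_rpow_add_le {m p r R L : ℝ} (hm : 0 ≤ m) (hp : 0 < p) (hpr : p ≤ r)
    (hrR : r ≤ R) (hL : m ^ (1 / p) + m ^ (1 / R) ≤ L) : m ≤ L ^ r := by
  have hR : 0 < R := hp.trans_le (hpr.trans hrR)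
  have h1 : m ^ (1 / p) ≤ L := by linarith [Real.rpow_nonneg hm (1 / R)]
  have h2 : m ^ (1 / R) ≤ L := by linarith [Real.rpow_nonneg hm (1 / p)]
  have hL0 : 0 ≤ L := (Real.rpow_nonneg hm _).trans h1
  have key : ∀ a : ℝ, 0 < a → m ^ (1 / a) ≤ L → m ≤ L ^ a := fun a ha h => by
    have := Real.rpow_le_rpow (Real.rpow_nonneg hm _) h ha.le
    rwa [← Real.rpow_mul hm, one_div_mul_cancel ha.ne', Real.rpow_one] at this
  rcases le_total 1 L with h | h
  · exact (key p hp h1).trans (Real.rpow_le_rpow_of_exponent_le h hpr)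
  · refine (key R hR h2).trans ?_
    rcases hL0.eq_or_lt with h0 | h0
    · rw [← h0, Real.zero_rpow hR.ne', Real.zero_rpow (hp.trans_le hpr).ne']
    · exact Real.rpow_le_rpow_of_exponent_ge h0 h hrR

end Powers

section NormComparison

variable {n : ℕ} {r : Fin n → ℝ} {P : Matrix (Fin n) (Fin n) ℝ} {R : ℝ}

theorem IsHomData.exists_homNorm_le (h : IsHomData r P) (hR : ∀ k, r k ≤ R) :
    ∃ C, 0 < C ∧ ∀ x, homNorm (diagonal r) P x ≤ C * ‖x‖ + (C * ‖x‖) ^ (1 / R) := by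
  obtain ⟨c, hc, hcz⟩ := exists_quad_le_norm_sq P
  refine ⟨√c, Real.sqrt_pos.2 hc, fun x => ?_⟩
  rcases eq_or_ne x 0 with rfl | hx
  · rw [homNorm_zero]; positivity
  set m := √c * ‖x‖ with hm
  have hm0 : 0 < m := mul_pos (Real.sqrt_pos.2 hc) (norm_pos_iff.2 hx)
  -- This L satisfies m ≤ L^{r_k} for every weight in [1, R], so scaling by L^{-r_k} brings each
  -- coordinate below 1/√c.
  set L := m + m ^ (1 / R) with hL
  have hL0 : 0 < L := by positivity
  rw [← Real.exp_log hL0, h.homNorm_le_exp]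
  refine (hcz _).trans ?_
  have hz : ‖scale r (-Real.log L) x‖ ≤ 1 / √c := by
    rw [pi_norm_le_iff_of_nonneg (by positivity)]
    intro k
    have h1 : m ≤ L ^ r k := le_rpow_of_rpow_add_le hm0.le one_pos (h.one_le k) (hR k)
      (by rw [div_one, Real.rpow_one])
    have h2 : Real.exp (-Real.log L * r k) = (L ^ r k)⁻¹ := by
      rw [neg_mul, Real.exp_neg, Real.rpow_def_of_pos hL0]
    rw [scale, h2, norm_mul, norm_inv, Real.norm_of_nonneg (by positivity), inv_mul_eq_div,
      div_le_div_iff₀ (by positivity) (by positivity)]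
    calc ‖x k‖ * √c ≤ ‖x‖ * √c := by gcongr; exact norm_le_pi_norm x k
      _ = m := by rw [hm, mul_comm]
      _ ≤ 1 * L ^ r k := by rwa [one_mul]
  calc c * ‖scale r (-Real.log L) x‖ ^ 2 ≤ c * (1 / √c) ^ 2 := by gcongr
    _ = 1 := by rw [div_pow, Real.sq_sqrt hc.le]; field_simp

theorem IsHomData.exists_norm_le (h : IsHomData r P) (hR : ∀ k, r k ≤ R) :
    ∃ C, 0 < C ∧ ∀ b x, quad P (scale r (-b) x) ≤ 1 →
      ‖x‖ ≤ C * (Real.exp b + Real.exp b ^ R) := by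
  obtain ⟨c, hc, hcz⟩ := exists_norm_sq_le_quad h.posDef
  refine ⟨√(1 / c), by positivity, fun b x hx => ?_⟩
  have hz : ‖scale r (-b) x‖ ≤ √(1 / c) := by
    apply Real.le_sqrt_of_sq_le
    rw [le_div_iff₀ hc, mul_comm]
    exact (hcz _).trans hx
  rw [pi_norm_le_iff_of_nonneg (by positivity)]
  intro k
  have h1 : x k = Real.exp (b * r k) * scale r (-b) x k := by
    rw [scale, ← mul_assoc, ← Real.exp_add]
    simp
  have h2 : Real.exp (b * r k) ≤ Real.exp b + Real.exp b ^ R := by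
    rw [← Real.exp_mul]
    rcases le_total 0 b with hb | hb
    · have : Real.exp (b * r k) ≤ Real.exp (b * R) :=
        Real.exp_le_exp.2 (mul_le_mul_of_nonneg_left (hR k) hb)
      linarith [Real.exp_pos b]
    · have : Real.exp (b * r k) ≤ Real.exp b :=
        Real.exp_le_exp.2 (by nlinarith [h.one_le k])
      linarith [Real.exp_pos (b * R)]
  rw [h1, norm_mul, Real.norm_of_nonneg (Real.exp_pos _).le, mul_comm]
  exact mul_le_mul ((norm_le_pi_norm _ k).trans hz) h2 (Real.exp_pos _).le (by positivity)

end NormComparison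

/-! ### Linear growth of the closed-loop field -/

section Growth

variable {n : ℕ} {μ : ℝ} {X : Matrix (Fin n) (Fin n) ℝ} {Y : Matrix (Fin 1) (Fin n) ℝ}

theorem exists_norm_mulVec_le {m : ℕ} (M : Matrix (Fin m) (Fin n) ℝ) :
    ∃ C, 0 ≤ C ∧ ∀ x, ‖M *ᵥ x‖ ≤ C * ‖x‖ := by
  refine ⟨‖LinearMap.toContinuousLinearMap M.mulVecLin‖, norm_nonneg _, fun x => ?_⟩
  exact (LinearMap.toContinuousLinearMap M.mulVecLin).le_opNorm x

theorem exists_loopField_growth (hμ : μ ∈ Set.Ioo (-1 : ℝ) 0)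
    (hd : IsHomData (chainWeight n μ) X⁻¹) :
    ∃ C, 0 ≤ C ∧ ∀ x, ‖loopField μ X Y x‖ ≤ C * (1 + ‖x‖) := by
  obtain ⟨a, ha, hA⟩ := exists_norm_mulVec_le (chainA n)
  obtain ⟨b, hb, hB⟩ := exists_norm_mulVec_le (chainB n)
  obtain ⟨c, hc, hF⟩ := exists_feedback_bound hd (Y * X⁻¹)
  obtain ⟨d, hd0, hV⟩ := hd.exists_homNorm_le (chainWeight_le hμ)
  refine ⟨a + b * c * (2 + 2 * d), by positivity, fun x => ?_⟩
  have h1 : homNorm (generator n μ) X⁻¹ x ^ (1 + μ) ≤ (2 + 2 * d) * (1 + ‖x‖) := by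
    refine (rpow_le_one_add (hd.homNorm_nonneg x) (by linarith [hμ.1]) (by linarith [hμ.2])).trans ?_
    have h2 := hV x
    have h3 : (d * ‖x‖) ^ (1 / ((n : ℝ) + 1)) ≤ 1 + d * ‖x‖ := by
      refine rpow_le_one_add (by positivity) (by positivity) ?_
      rw [div_le_one (by positivity)]
      linarith [(Nat.cast_nonneg n : (0 : ℝ) ≤ n)]
    nlinarith [norm_nonneg x]
  calc ‖loopField μ X Y x‖
      ≤ a * ‖x‖ + b * (c * homNorm (generator n μ) X⁻¹ x ^ (1 + μ)) := by
        refine (norm_add_le _ _).trans (add_le_add (hA x) ((hB _).trans ?_))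
        gcongr
        exact hF x
    _ ≤ a * (1 + ‖x‖) + b * (c * ((2 + 2 * d) * (1 + ‖x‖))) := by
        gcongr
        linarith
    _ = _ := by ring

end Growth

/-! ### Homogeneity in state and input -/

section ExtendedDilation

variable {n N : ℕ} {μ : ℝ}

theorem extDil_eq (s : ℝ) (p : (Fin N → Fin n → ℝ) × (Fin N → Fin n → ℝ)) :
    extDil μ s p = (fun i => scale (chainWeight n μ) s (p.1 i),
      fun i => Real.exp (μ * s) • scale (chainWeight n μ) s (p.2 i)) := by
  unfold extDil
  simp only [generator_eq_diagonal, dil_diagonal_mulVec]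
  rfl

theorem isDilation_extDil (hμ : μ ∈ Set.Ioo (-1 : ℝ) 0) :
    IsDilation (extDil μ :
      ℝ → (Fin N → Fin n → ℝ) × (Fin N → Fin n → ℝ) →
        (Fin N → Fin n → ℝ) × (Fin N → Fin n → ℝ)) where
  zero x := by
    rw [extDil_eq]
    simp [scale_zero_left]
  add a b x := by
    simp only [extDil_eq, scale_add, scale_smul, smul_smul, mul_add, Real.exp_add]
  atTop x hx := by
    have key : ∀ w y : ℝ, 0 < w → y ≠ 0 →
        Tendsto (fun s : ℝ => Real.exp (s * w) * |y|) atTop atTop := fun w y hw hy =>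
      (Real.tendsto_exp_atTop.comp (tendsto_id.atTop_mul_const hw)).atTop_mul_const (abs_pos.2 hy)
    by_cases h1 : x.1 = 0
    · have h2 : x.2 ≠ 0 := fun h2 => hx (Prod.ext h1 h2)
      obtain ⟨i, hi⟩ := Function.ne_iff.1 h2
      obtain ⟨k, hk⟩ := Function.ne_iff.1 hi
      -- The input coordinates carry the weights μ + r_k ≥ 1 + μ, positive because μ > -1.
      have hw : 0 < μ + chainWeight n μ k := by linarith [one_le_chainWeight hμ k, hμ.1]
      refine tendsto_atTop_mono (fun s => ?_) (key _ _ hw hk)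
      refine le_trans ?_ ((norm_le_pi_norm _ k).trans ((norm_le_pi_norm _ i).trans
        (norm_snd_le (extDil μ s x))))
      rw [extDil_eq]
      simp only [Pi.smul_apply, scale, smul_eq_mul]
      rw [← mul_assoc, ← Real.exp_add, norm_mul, Real.norm_of_nonneg (Real.exp_pos _).le,
        Real.norm_eq_abs]
      apply le_of_eq
      ring_nf
    · obtain ⟨i, hi⟩ := Function.ne_iff.1 h1
      obtain ⟨k, hk⟩ := Function.ne_iff.1 hi
      have hw : 0 < chainWeight n μ k := by linarith [one_le_chainWeight hμ k]
      refine tendsto_atTop_mono (fun s => ?_) (key _ _ hw hk)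
      refine le_trans ?_ ((norm_le_pi_norm _ k).trans ((norm_le_pi_norm _ i).trans
        (norm_fst_le (extDil μ s x))))
      rw [extDil_eq]
      simp only [scale]
      rw [norm_mul, Real.norm_of_nonneg (Real.exp_pos _).le, Real.norm_eq_abs]
  atBot x _ := by
    have key : ∀ w y : ℝ, 0 < w → Tendsto (fun s : ℝ => Real.exp (s * w) * y) atBot (𝓝 0) :=
      fun w y hw => by
        have h1 : Tendsto (fun s : ℝ => s * w) atBot atBot := tendsto_id.atBot_mul_const hw
        simpa using (Real.tendsto_exp_atBot.comp h1).mul_const y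
    have h : Tendsto (fun s => extDil μ s x) atBot (𝓝 (0, 0)) := by
      simp only [extDil_eq]
      refine Tendsto.prodMk_nhds ?_ ?_ <;> simp only [tendsto_pi_nhds] <;> intro i k
      · exact key _ _ (by linarith [one_le_chainWeight hμ k])
      · refine (key (μ + chainWeight n μ k) (x.2 i k)
          (by linarith [one_le_chainWeight hμ k, hμ.1])).congr fun s => ?_
        simp only [Pi.smul_apply, scale, smul_eq_mul]
        rw [← mul_assoc, ← Real.exp_add]
        ring_nf
    simpa using h.norm

theorem isHomogeneousField_errorField (hμ : μ ∈ Set.Ioo (-1 : ℝ) 0) {X : Matrix (Fin n) (Fin n) ℝ}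
    {Y : Matrix (Fin 1) (Fin n) ℝ} (hd : IsHomData (chainWeight n μ) X⁻¹) :
    IsHomogeneousField (extDil μ) μ
      (fun p : (Fin N → Fin n → ℝ) × (Fin N → Fin n → ℝ) => (errorField μ X Y p.1 p.2, 0)) := by
  refine ⟨isDilation_extDil hμ, fun s x => ?_⟩
  simp only [extDil_eq]
  refine Prod.ext ?_ ?_
  · funext i
    simp only [errorField_apply, loopField_scale hd, scale_add_right, Prod.smul_fst, Pi.smul_apply,
      smul_add]
  · funext i
    simp [scale_zero_right]

end ExtendedDilation

/-! ### Barrier argument for paths with a Lipschitz disturbance -/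

section Barrier

variable {n : ℕ} {r : Fin n → ℝ} {P : Matrix (Fin n) (Fin n) ℝ}

theorem abs_dotProduct_scale_le {ρ δ' s : ℝ} {v w : Fin n → ℝ} (hv : ‖v‖ ≤ δ' * ρ) :
    scale r s v ⬝ᵥ w ≤ δ' * ρ * ∑ k, Real.exp (s * r k) * |w k| := by
  rw [dotProduct, Finset.mul_sum]
  refine Finset.sum_le_sum fun k _ => ?_
  have h1 : |v k| ≤ δ' * ρ := (norm_le_pi_norm v k).trans hv
  calc scale r s v k * w k ≤ |scale r s v k * w k| := le_abs_self _
    _ = |v k| * (Real.exp (s * r k) * |w k|) := by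
      rw [scale, abs_mul, abs_mul, abs_of_pos (Real.exp_pos _)]; ring
    _ ≤ δ' * ρ * (Real.exp (s * r k) * |w k|) := by gcongr

theorem norm_scale_le (s : ℝ) (v : Fin n → ℝ) :
    ‖scale r s v‖ ≤ (∑ k, Real.exp (s * r k)) * ‖v‖ := by
  rw [pi_norm_le_iff_of_nonneg (by positivity)]
  intro k
  rw [scale, norm_mul, Real.norm_of_nonneg (Real.exp_pos _).le]
  gcongr
  · exact Finset.single_le_sum (f := fun k => Real.exp (s * r k))
      (fun k _ => (Real.exp_pos _).le) (Finset.mem_univ k)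
  · exact norm_le_pi_norm v k

/-- If the derivative of the quadratic form along the rescaled drift is negative, and dominates the
effect of a Lipschitz disturbance, then the rescaled path enters the unit ball. -/
theorem eventually_quad_scale_le (hP : P.PosDef) {x Q : ℝ → Fin n → ℝ} {b : ℝ → ℝ}
    {t b' δ : ℝ} {F : Fin n → ℝ} (hb : HasDerivAt b b' t)
    (hx : HasDerivWithinAt (fun s => x s - Q s) F (Set.Ioi t) t)
    (hQ : ∀ s, t ≤ s → ‖Q s - Q t‖ ≤ δ * (s - t))
    (h1 : quad P (scale r (-b t) (x t)) = 1)
    (hneg : scale r (-b t) (x t) ⬝ᵥ (P *ᵥ ((-b') • (fun k => r k * scale r (-b t) (x t) k)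
        + scale r (-b t) F))
      + δ * ∑ k, Real.exp (-b t * r k) * |(P *ᵥ scale r (-b t) (x t)) k| < 0) :
    ∀ᶠ s in 𝓝[>] t, quad P (scale r (-b s) (x s)) ≤ 1 := by
  obtain ⟨c, hc, hcz⟩ := exists_quad_le_norm_sq P
  set Z := scale r (-b t) (x t) with hZ
  -- Here the disturbance is frozen at its value at time t, so p is right-differentiable at t. The
  -- true path differs from p by the dilated increment Q s - Q t, of size O(s - t).
  set p : ℝ → Fin n → ℝ := fun s => scale r (-b s) (x s - Q s + Q t) with hp
  have hpt : p t = Z := by simp [hp, hZ]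
  have hpd : HasDerivWithinAt p ((-b') • (fun k => r k * Z k) + scale r (-b t) F)
      (Set.Ioi t) t := by
    rw [hasDerivWithinAt_pi]
    intro k
    have hxk := ((hasDerivWithinAt_pi.1 hx) k).add_const (Q t k)
    have he := (((hb.hasDerivWithinAt (s := Set.Ioi t)).neg).mul_const (r k)).exp
    refine (he.mul hxk).congr_deriv ?_
    simp only [hZ, scale, Pi.add_apply, Pi.smul_apply, smul_eq_mul, Pi.sub_apply, Pi.neg_apply]
    ring
  have hpc : Tendsto p (𝓝[>] t) (𝓝 Z) := hpt ▸ hpd.continuousWithinAt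
  have hbc : Tendsto b (𝓝[>] t) (𝓝 (b t)) := hb.continuousAt.tendsto.mono_left nhdsWithin_le_nhds
  have hqd := hasDerivWithinAt_quad hP.isHermitian hpd
  rw [hasDerivWithinAt_iff_tendsto_slope' (by simp), hpt] at hqd
  have hPw : Continuous fun z => P *ᵥ z := by fun_prop
  have hu : Tendsto (fun s => ∑ k, Real.exp (-b s * r k) * |(P *ᵥ p s) k|) (𝓝[>] t)
      (𝓝 (∑ k, Real.exp (-b t * r k) * |(P *ᵥ Z) k|)) := by
    refine tendsto_finsetSum _ fun k _ => ?_
    refine Tendsto.mul ?_ ?_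
    · exact (Real.continuous_exp.tendsto _).comp (hbc.neg.mul_const _)
    · exact ((tendsto_pi_nhds.1 ((hPw.tendsto Z).comp hpc)) k).abs
  have hM : Tendsto (fun s => ∑ k, Real.exp (-b s * r k)) (𝓝[>] t)
      (𝓝 (∑ k, Real.exp (-b t * r k))) :=
    tendsto_finsetSum _ fun k _ => (Real.continuous_exp.tendsto _).comp (hbc.neg.mul_const _)
  have hid : Tendsto (fun s => s - t) (𝓝[>] t) (𝓝 0) := by
    have : Continuous fun s : ℝ => s - t := by fun_prop
    simpa using (this.tendsto t).mono_left nhdsWithin_le_nhds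
  -- The three summands bound the difference quotient of the form along the true path: the slope
  -- along p, the cross term with the increment of Q, and the increment's own form, which is O((s -
  -- t)²) and drops out in the limit.
  have hlim := (hqd.add (hu.const_mul (2 * δ))).add
    ((((hM.mul_const δ).pow 2).const_mul c).mul hid)
  rw [mul_zero, add_zero] at hlim
  have hev := hlim.eventually_lt_const (u := 0) (by linarith)
  filter_upwards [hev, self_mem_nhdsWithin] with s hs hts
  have hst : 0 < s - t := sub_pos.2 hts
  have hQs := hQ s (le_of_lt hts)
  have hsplit : scale r (-b s) (x s) = p s + scale r (-b s) (Q s - Q t) := by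
    rw [hp, ← scale_add_right]
    congr 1
    abel
  have hcross := abs_dotProduct_scale_le (r := r) (s := -b s) (w := P *ᵥ p s) hQs
  have hρ : quad P (scale r (-b s) (Q s - Q t))
      ≤ c * ((∑ k, Real.exp (-b s * r k)) * δ) ^ 2 * (s - t) * (s - t) := by
    refine (hcz _).trans ?_
    have := norm_scale_le (r := r) (-b s) (Q s - Q t)
    have h2 : ‖scale r (-b s) (Q s - Q t)‖ ≤ (∑ k, Real.exp (-b s * r k)) * (δ * (s - t)) := by
      refine this.trans ?_
      gcongr
    calc c * ‖scale r (-b s) (Q s - Q t)‖ ^ 2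
        ≤ c * ((∑ k, Real.exp (-b s * r k)) * (δ * (s - t))) ^ 2 := by gcongr
      _ = _ := by ring
  rw [hsplit, quad_add hP.isHermitian, ← dotProduct_mulVec_comm_of_symm hP.isHermitian]
  have hslope : quad P (p s) = 1 + slope (fun t => quad P (p t)) t s * (s - t) := by
    rw [slope_def_field, hpt, h1]
    field_simp
    ring
  rw [hslope]
  have := mul_neg_of_neg_of_pos hs hst
  nlinarith

/-- Comparison principle: the level `exp (b t)` of the homogeneous norm is a barrier. -/
theorem quad_scale_le_one_of_barrier (hP : P.PosDef) {x Q F : ℝ → Fin n → ℝ} {b b' : ℝ → ℝ}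
    {τ δ : ℝ} (hxc : ContinuousOn x (Set.Icc 0 τ)) (hb : ∀ t, HasDerivAt b (b' t) t)
    (hx : ∀ t ∈ Set.Ico 0 τ, HasDerivWithinAt (fun s => x s - Q s) (F t) (Set.Ioi t) t)
    (hQ : ∀ t s, 0 ≤ t → t ≤ s → ‖Q s - Q t‖ ≤ δ * (s - t))
    (h0 : quad P (scale r (-b 0) (x 0)) ≤ 1)
    (hneg : ∀ t ∈ Set.Ico 0 τ, quad P (scale r (-b t) (x t)) = 1 →
      scale r (-b t) (x t) ⬝ᵥ (P *ᵥ ((-b' t) • (fun k => r k * scale r (-b t) (x t) k)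
        + scale r (-b t) (F t)))
      + δ * ∑ k, Real.exp (-b t * r k) * |(P *ᵥ scale r (-b t) (x t)) k| < 0) :
    ∀ t ∈ Set.Icc 0 τ, quad P (scale r (-b t) (x t)) ≤ 1 := by
  have hbc : Continuous b := continuous_iff_continuousAt.2 fun t => (hb t).continuousAt
  have hψ : ContinuousOn (fun t => quad P (scale r (-b t) (x t))) (Set.Icc 0 τ) :=
    (continuous_quad_scale (P := P) (r := r)).comp_continuousOn
      (f := fun t => (b t, x t)) (hbc.continuousOn.prodMk hxc)
  -- Continuous induction: below the level continuity suffices, and at contact the strict inequality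
  -- `hneg` pushes the path back.
  refine IsClosed.Icc_subset_of_forall_mem_nhdsWithin
    (s := {t | quad P (scale r (-b t) (x t)) ≤ 1}) ?_ h0 ?_
  · have := hψ.preimage_isClosed_of_isClosed isClosed_Icc (isClosed_Iic (a := (1 : ℝ)))
    rwa [Set.inter_comm] at this
  · rintro t ⟨ht1, ht⟩
    rcases (show quad P (scale r (-b t) (x t)) ≤ 1 from ht1).lt_or_eq with hlt | heq
    · have h1 : Tendsto (fun t => quad P (scale r (-b t) (x t))) (𝓝[>] t)
          (𝓝 (quad P (scale r (-b t) (x t)))) :=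
        (hψ t ⟨ht.1, ht.2.le⟩).mono_of_mem_nhdsWithin
          (mem_of_superset (Ioc_mem_nhdsGT ht.2) fun s hs => ⟨ht.1.trans hs.1.le, hs.2⟩)
      exact (h1.eventually_lt_const hlt).mono fun s hs => hs.le
    · exact eventually_quad_scale_le hP (hb t) (hx t ht) (fun s hs => hQ t s ht.1 hs) heq
        (hneg t ht heq)

end Barrier

/-! ### Decay estimate for a single agent -/

section BlockEstimate

variable {n : ℕ} {μ : ℝ} {X : Matrix (Fin n) (Fin n) ℝ} {Y : Matrix (Fin 1) (Fin n) ℝ}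

/-- The decaying level, raised to the power `-μ`. -/
noncomputable def levelPow (c W θ t : ℝ) : ℝ := W * Real.exp (-(c * t / (1 + W))) + θ

theorem exists_dissipation_bounds (hμ : μ ∈ Set.Ioo (-1 : ℝ) 0) (hX : X.PosDef)
    (hGX : (generator n μ * X + X * generator n μ).PosDef)
    (hLMI : (-(chainA n * X + X * (chainA n)ᵀ - chainB n * Y - Yᵀ * (chainB n)ᵀ)).PosDef) :
    ∃ a g H, 0 < a ∧ 0 < g ∧ 0 < H ∧ ∀ z, quad X⁻¹ z = 1 →
      z ⬝ᵥ (X⁻¹ *ᵥ loopField μ X Y z) ≤ -a ∧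
      z ⬝ᵥ (X⁻¹ *ᵥ fun k => chainWeight n μ k * z k) ≤ g ∧
      ∑ k, |(X⁻¹ *ᵥ z) k| ≤ H := by
  have hd := isHomData_chain hμ hX hGX
  obtain ⟨c1, hc1, hc1z⟩ := exists_norm_sq_le_quad hX.inv
  obtain ⟨c2, hc2, hc2z⟩ := exists_quad_le_norm_sq X⁻¹
  obtain ⟨a, ha, haz⟩ := exists_mul_norm_sq_le
    (f := fun z => -(z ⬝ᵥ (X⁻¹ *ᵥ (chainA n *ᵥ z - chainB n *ᵥ ((Y * X⁻¹) *ᵥ z)))))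
    (by fun_prop)
    (fun a z => by
      simp only [mulVec_smul, ← smul_sub, dotProduct_smul, smul_dotProduct, smul_eq_mul]
      ring)
    (fun z hz => neg_pos.2 (closedLoop_dissipative hX hLMI hz))
  obtain ⟨g, hg, hgz⟩ := exists_abs_le_mul_norm_sq
    (f := fun z => z ⬝ᵥ (X⁻¹ *ᵥ fun k => chainWeight n μ k * z k))
    (by fun_prop)
    (fun a z => by
      have : (fun k => chainWeight n μ k * (a • z) k)
          = a • fun k => chainWeight n μ k * z k := by
        funext k
        simp only [Pi.smul_apply, smul_eq_mul]
        ring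
      rw [this]
      simp only [mulVec_smul, dotProduct_smul, smul_dotProduct, smul_eq_mul]
      ring)
  obtain ⟨H, hH⟩ := (isCompact_closedBall (0 : Fin n → ℝ) (√(1 / c1))).exists_bound_of_continuousOn
    (f := fun z => ∑ k, |(X⁻¹ *ᵥ z) k|) (by fun_prop)
  refine ⟨a / c2, g / c1, max H 1, by positivity, by positivity, by positivity, fun z hz => ?_⟩
  have h1 : ‖z‖ ^ 2 ≤ 1 / c1 := by
    rw [le_div_iff₀ hc1, mul_comm, ← hz]
    exact hc1z z
  have h2 : 1 / c2 ≤ ‖z‖ ^ 2 := by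
    rw [div_le_iff₀ hc2, mul_comm, ← hz]
    exact hc2z z
  refine ⟨?_, ?_, ?_⟩
  · rw [loopField_of_quad_eq_one hd hz]
    have h3 := haz z
    have h4 : a / c2 ≤ a * ‖z‖ ^ 2 := by
      rw [div_eq_mul_one_div]
      gcongr
    linarith
  · refine (le_abs_self _).trans ((hgz z).trans ?_)
    rw [div_eq_mul_one_div]
    gcongr
  · refine le_trans ?_ (le_max_left H 1)
    refine (le_abs_self _).trans (hH z ?_)
    rw [mem_closedBall_zero_iff]
    exact Real.le_sqrt_of_sq_le h1

/-- The conclusion says that V(x t) ≤ w(t)^{1/(-μ)} for the level w = `levelPow`. The rate c/(1+W)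
bounds the slope of w by c whatever W is, as needed against a dissipation of V^{-μ} that does not
grow with V. -/
theorem exists_block_estimate (hμ : μ ∈ Set.Ioo (-1 : ℝ) 0) (hX : X.PosDef)
    (hGX : (generator n μ * X + X * generator n μ).PosDef)
    (hLMI : (-(chainA n * X + X * (chainA n)ᵀ - chainB n * Y - Yᵀ * (chainB n)ᵀ)).PosDef) :
    ∃ c D, 0 < c ∧ 0 < D ∧ ∀ (x Q : ℝ → Fin n → ℝ) (τ δ W θ : ℝ),
      ContinuousOn x (Set.Icc 0 τ) →
      (∀ t ∈ Set.Ico 0 τ,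
        HasDerivWithinAt (fun s => x s - Q s) (loopField μ X Y (x t)) (Set.Ioi t) t) →
      (∀ t s, 0 ≤ t → t ≤ s → ‖Q s - Q t‖ ≤ δ * (s - t)) → 0 ≤ δ → 0 ≤ W → 0 < θ →
      (D * δ) ^ (1 / (1 + μ)) + (D * δ) ^ (1 / ((n : ℝ) + 1)) ≤ θ ^ (1 / -μ) →
      homNorm (generator n μ) X⁻¹ (x 0) ≤ (W + θ) ^ (1 / -μ) →
      ∀ t ∈ Set.Icc 0 τ, quad X⁻¹ (scale (chainWeight n μ)
        (-(1 / -μ * Real.log (levelPow c W θ t))) (x t)) ≤ 1 := by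
  have hd := isHomData_chain hμ hX hGX
  obtain ⟨a, g, H, ha, hg, hH, hbd⟩ := exists_dissipation_bounds hμ hX hGX hLMI
  have hκ : 0 < -μ := neg_pos.2 hμ.2
  have hμ0 : μ ≠ 0 := hμ.2.ne
  -- The constants split the dissipation a: a/4 absorbs the motion of the level, a/2 the
  -- disturbance, and a/4 remains to keep the inequality strict.
  refine ⟨-μ * a / (4 * g), 2 * H / a, by positivity, by positivity,
    fun x Q τ δ W θ hxc hx hQ hδ hW hθ hδθ h0 => ?_⟩
  set c := -μ * a / (4 * g) with hc
  have hc0 : 0 < c := by positivity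
  have hwpos : ∀ t, 0 < levelPow c W θ t := fun t => by unfold levelPow; positivity
  have hwd : ∀ t, HasDerivAt (levelPow c W θ)
      (-(c * (W / (1 + W) * Real.exp (-(c * t / (1 + W)))))) t := by
    intro t
    have := ((((((hasDerivAt_id t).const_mul c).div_const (1 + W)).neg).exp).const_mul W).add_const θ
    refine HasDerivAt.congr_deriv this ?_
    simp only [id, Pi.neg_apply]
    field_simp
  have hbder : ∀ t, HasDerivAt (fun t => 1 / -μ * Real.log (levelPow c W θ t))
      (1 / -μ * (-(c * (W / (1 + W) * Real.exp (-(c * t / (1 + W))))) / levelPow c W θ t)) t :=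
    fun t => ((hwd t).log (hwpos t).ne').const_mul _
  refine quad_scale_le_one_of_barrier (r := chainWeight n μ) hX.inv hxc hbder hx hQ ?_ ?_
  · have hw0 : levelPow c W θ 0 = W + θ := by simp [levelPow]
    rw [← hd.homNorm_le_exp, ← generator_eq_diagonal, hw0, mul_comm,
      ← Real.rpow_def_of_pos (by positivity)]
    exact h0
  · intro t ht hquad
    set w := levelPow c W θ t with hw
    have hw0 : 0 < w := hwpos t
    set b := 1 / -μ * Real.log w with hb
    set Z := scale (chainWeight n μ) (-b) (x t) with hZ
    obtain ⟨hb1, hb2, hb3⟩ := hbd Z hquad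
    have hxt : x t = scale (chainWeight n μ) b Z := by
      rw [hZ, ← scale_add, add_neg_cancel, scale_zero_left]
    -- Since w = e^{-μb}, homogeneity gives the rescaled field the factor 1/w, the same as in b' =
    -- w'/(-μw). All three terms of the balance thus compare at the common scale 1/w.
    have hexp : Real.exp (μ * b) = w⁻¹ := by
      have : μ * b = -Real.log w := by
        rw [hb]
        field_simp
      rw [this, Real.exp_neg, Real.exp_log hw0]
    have hF : scale (chainWeight n μ) (-b) (loopField μ X Y (x t)) = w⁻¹ • loopField μ X Y Z := by
      rw [hxt, loopField_scale hd, scale_smul, ← scale_add, neg_add_cancel, scale_zero_left, hexp]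
    have hslope : 1 / -μ * (c * (W / (1 + W) * Real.exp (-(c * t / (1 + W))))) * g
        ≤ a / 4 := by
      have h1 : W / (1 + W) ≤ 1 := by
        rw [div_le_one (by positivity)]; linarith
      have h2 : Real.exp (-(c * t / (1 + W))) ≤ 1 := by
        rw [Real.exp_le_one_iff]
        have : 0 ≤ c * t / (1 + W) := div_nonneg (mul_nonneg hc0.le ht.1) (by positivity)
        linarith
      calc 1 / -μ * (c * (W / (1 + W) * Real.exp (-(c * t / (1 + W))))) * g
          ≤ 1 / -μ * (c * (1 * 1)) * g := by gcongr
        _ = a / 4 := by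
          rw [hc]
          field_simp
    -- After factoring out 1/w, the disturbance in coordinate k must be dominated by e^{b(r_k + μ)}.
    -- These exponents lie in [1 + μ, n + 1], the range covered by the two roots in the condition on
    -- θ.
    have hdist : ∀ k, δ * Real.exp (-b * chainWeight n μ k) * H ≤ a / 2 * w⁻¹ := by
      intro k
      have hE : θ ^ (1 / -μ) ≤ Real.exp b := by
        rw [hb, mul_comm, ← Real.rpow_def_of_pos hw0]
        apply Real.rpow_le_rpow hθ.le _ (by positivity)
        rw [hw, levelPow]
        have : 0 ≤ W * Real.exp (-(c * t / (1 + W))) := by positivity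
        linarith
      have h1 : 2 * H / a * δ ≤ Real.exp b ^ (chainWeight n μ k + μ) :=
        le_rpow_of_rpow_add_le (by positivity) (by linarith [hμ.1])
          (by linarith [one_le_chainWeight hμ k]) (by linarith [chainWeight_le hμ k, hμ.2])
          (hδθ.trans hE)
      rw [← Real.exp_mul] at h1
      have h2 : Real.exp (-b * chainWeight n μ k)
          * Real.exp (b * (chainWeight n μ k + μ)) = w⁻¹ := by
        rw [← hexp, ← Real.exp_add]
        ring_nf
      have h3 : δ * H ≤ a / 2 * Real.exp (b * (chainWeight n μ k + μ)) := by
        calc δ * H = a / 2 * (2 * H / a * δ) := by field_simp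
          _ ≤ _ := by gcongr
      calc δ * Real.exp (-b * chainWeight n μ k) * H
          = Real.exp (-b * chainWeight n μ k) * (δ * H) := by ring
        _ ≤ Real.exp (-b * chainWeight n μ k)
            * (a / 2 * Real.exp (b * (chainWeight n μ k + μ))) := by gcongr
        _ = a / 2 * w⁻¹ := by rw [← h2]; ring
    have hsum : δ * ∑ k, Real.exp (-b * chainWeight n μ k) * |(X⁻¹ *ᵥ Z) k| ≤ a / 2 * w⁻¹ := by
      have h1 : ∀ k, δ * Real.exp (-b * chainWeight n μ k) ≤ a / 2 * w⁻¹ / H := fun k => by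
        rw [le_div_iff₀ hH]; exact hdist k
      calc δ * ∑ k, Real.exp (-b * chainWeight n μ k) * |(X⁻¹ *ᵥ Z) k|
          = ∑ k, δ * Real.exp (-b * chainWeight n μ k) * |(X⁻¹ *ᵥ Z) k| := by
            rw [Finset.mul_sum]; exact Finset.sum_congr rfl fun k _ => by ring
        _ ≤ ∑ k, a / 2 * w⁻¹ / H * |(X⁻¹ *ᵥ Z) k| :=
            Finset.sum_le_sum fun k _ => by gcongr; exact h1 k
        _ = a / 2 * w⁻¹ / H * ∑ k, |(X⁻¹ *ᵥ Z) k| := by rw [Finset.mul_sum]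
        _ ≤ a / 2 * w⁻¹ / H * H := by gcongr
        _ = a / 2 * w⁻¹ := by field_simp
    rw [hF, mulVec_add, mulVec_smul, mulVec_smul, dotProduct_add, dotProduct_smul, dotProduct_smul,
      smul_eq_mul, smul_eq_mul]
    have hterm1 : -(1 / -μ * (-(c * (W / (1 + W) * Real.exp (-(c * t / (1 + W))))) / w))
        * (Z ⬝ᵥ (X⁻¹ *ᵥ fun k => chainWeight n μ k * Z k)) ≤ a / 4 * w⁻¹ := by
      set S := c * (W / (1 + W) * Real.exp (-(c * t / (1 + W)))) with hS
      have hS0 : 0 ≤ S := by positivity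
      calc _ = 1 / -μ * S * (Z ⬝ᵥ (X⁻¹ *ᵥ fun k => chainWeight n μ k * Z k)) * w⁻¹ := by
            field_simp
        _ ≤ 1 / -μ * S * g * w⁻¹ := by gcongr
        _ ≤ a / 4 * w⁻¹ := by gcongr
    have hterm2 : w⁻¹ * (Z ⬝ᵥ (X⁻¹ *ᵥ loopField μ X Y Z)) ≤ w⁻¹ * -a := by gcongr
    have : 0 < a * w⁻¹ := by positivity
    linarith

end BlockEstimate

/-! ### Comparison functions -/

section ComparisonFunctions

theorem IsClassK.comp {α σ : ℝ≥0 → ℝ≥0} (hα : IsClassK α) (hσ : IsClassK σ) :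
    IsClassK fun s => α (σ s) :=
  ⟨hα.continuous.comp hσ.continuous, hα.strictMono.comp hσ.strictMono, by
    rw [hσ.map_zero, hα.map_zero]⟩

theorem IsClassK.add {α σ : ℝ≥0 → ℝ≥0} (hα : IsClassK α) (hσ : IsClassK σ) :
    IsClassK fun s => α s + σ s :=
  ⟨hα.continuous.add hσ.continuous, hα.strictMono.add hσ.strictMono, by
    rw [hσ.map_zero, hα.map_zero, add_zero]⟩

theorem IsClassK.pos {α : ℝ≥0 → ℝ≥0} (hα : IsClassK α) {s : ℝ≥0} (hs : 0 < s) : 0 < α s := by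
  have := hα.strictMono hs
  rwa [hα.map_zero] at this

theorem isClassK_const_mul {c : ℝ≥0} (hc : 0 < c) : IsClassK fun s => c * s :=
  ⟨by fun_prop, fun _ _ h => mul_lt_mul_of_pos_left h hc, mul_zero c⟩

theorem isClassK_rpow {p : ℝ} (hp : 0 < p) : IsClassK fun s : ℝ≥0 => s ^ p :=
  ⟨NNReal.continuous_rpow_const hp.le, NNReal.strictMono_rpow_of_pos hp, NNReal.zero_rpow hp.ne'⟩

/-- The weak triangle inequality for monotone functions. -/
theorem IsClassK.map_add_le {α : ℝ≥0 → ℝ≥0} (hα : IsClassK α) (a b : ℝ≥0) :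
    α (a + b) ≤ α (2 * a) + α (2 * b) := by
  rcases le_total a b with h | h
  · refine le_add_left (hα.strictMono.monotone ?_)
    rw [two_mul]; gcongr
  · refine le_add_right (hα.strictMono.monotone ?_)
    rw [two_mul]; gcongr

theorem IsClassKL.comp {β : ℝ≥0 → ℝ≥0 → ℝ≥0} {α σ : ℝ≥0 → ℝ≥0} (hβ : IsClassKL β)
    (hα : IsClassK α) (hσ : IsClassK σ) : IsClassKL fun s t => α (β (σ s) t) where
  classK t := hα.comp ((hβ.classK t).comp hσ)
  continuous s := hα.continuous.comp (hβ.continuous (σ s))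
  strictAnti s hs := hα.strictMono.comp_strictAnti (hβ.strictAnti (σ s) (hσ.pos hs))
  tendsto_zero s := by
    have := (hα.continuous.tendsto 0).comp (hβ.tendsto_zero (σ s))
    rwa [hα.map_zero] at this

/-- The decay function `w exp(-c t / (1 + w))`. -/
noncomputable def decay (c : ℝ) (w t : ℝ≥0) : ℝ≥0 :=
  w * (Real.exp (-(c * t / (1 + w)))).toNNReal

theorem coe_decay (c : ℝ) (w t : ℝ≥0) :
    (decay c w t : ℝ) = w * Real.exp (-(c * t / (1 + w))) := by
  rw [decay, NNReal.coe_mul, Real.coe_toNNReal _ (Real.exp_pos _).le]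

/-- The 1 + w in the rate does not spoil monotonicity in w: a larger w slows the decay, so both
factors are nondecreasing in w. -/
theorem isClassKL_decay {c : ℝ} (hc : 0 < c) : IsClassKL (decay c) where
  classK t := by
    refine ⟨?_, fun w w' hw => ?_, by simp [decay]⟩
    · unfold decay
      refine continuous_id.mul (continuous_real_toNNReal.comp (Real.continuous_exp.comp ?_))
      refine (Continuous.div (by fun_prop) (by fun_prop) fun w => ?_).neg
      positivity
    · rw [← NNReal.coe_lt_coe, coe_decay, coe_decay]
      have hw' : (w : ℝ) < w' := hw
      have h1 : Real.exp (-(c * t / (1 + w))) ≤ Real.exp (-(c * t / (1 + w'))) := by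
        gcongr
      exact mul_lt_mul hw' h1 (Real.exp_pos _) w'.2
  continuous w := by
    unfold decay
    refine continuous_const.mul (continuous_real_toNNReal.comp (Real.continuous_exp.comp ?_))
    fun_prop
  strictAnti w hw t t' ht := by
    rw [← NNReal.coe_lt_coe, coe_decay, coe_decay]
    have ht' : (t : ℝ) < t' := ht
    have hw' : (0 : ℝ) < w := hw
    gcongr
  tendsto_zero w := by
    rw [← NNReal.tendsto_coe]
    simp only [coe_decay]
    have h1 : Tendsto (fun t : ℝ≥0 => c * (t : ℝ) / (1 + w)) atTop atTop :=
      (Tendsto.const_mul_atTop hc (NNReal.tendsto_coe_atTop.2 tendsto_id)).atTop_div_const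
        (by positivity)
    have h2 := (Real.tendsto_exp_atBot.comp (tendsto_neg_atTop_atBot.comp h1)).const_mul (w : ℝ)
    simpa using h2

end ComparisonFunctions

/-! ### Essentially bounded inputs and their primitives -/

section EssentiallyBoundedInputs

variable {F : Type*} [NormedAddCommGroup F]

theorem ae_nnnorm_le_of_memLp_top {ν : Measure ℝ} {q : ℝ → F} (hq : MemLp q ⊤ ν) :
    ∀ᵐ s ∂ν, ‖q s‖ ≤ (eLpNorm q ⊤ ν).toNNReal := by
  have hfin : eLpNorm q ⊤ ν ≠ ⊤ := hq.2.ne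
  rw [eLpNorm_exponent_top] at hfin ⊢
  filter_upwards [ae_le_eLpNormEssSup (f := q) (μ := ν)] with s hs
  rw [← coe_nnnorm, NNReal.coe_le_coe, ← ENNReal.coe_le_coe, ENNReal.coe_toNNReal hfin]
  exact hs

theorem intervalIntegrable_of_memLp_top {q : ℝ → F} (hq : MemLp q ⊤ volume) (a b : ℝ) :
    IntervalIntegrable q volume a b :=
  ⟨(hq.restrict _).integrable le_top, (hq.restrict _).integrable le_top⟩

variable [NormedSpace ℝ F]

/-- The restriction to 0 ≤ t is essential, because `inputNorm` sees only positive times. For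
existence `lipschitzWith_primitive` uses the norm over all of ℝ. -/
theorem norm_integral_sub_le_inputNorm {q : ℝ → F} (hq : MemLp q ⊤ volume) {t s : ℝ} (ht : 0 ≤ t)
    (hts : t ≤ s) :
    ‖(∫ r in (0 : ℝ)..s, q r) - ∫ r in (0 : ℝ)..t, q r‖ ≤ inputNorm q * (s - t) := by
  rw [intervalIntegral.integral_interval_sub_left (intervalIntegrable_of_memLp_top hq _ _)
    (intervalIntegrable_of_memLp_top hq _ _)]
  rw [← abs_of_nonneg (sub_nonneg.2 hts)]
  apply intervalIntegral.norm_integral_le_of_norm_le_const_ae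
  have h := ae_nnnorm_le_of_memLp_top (hq.restrict (Set.Ioi 0))
  rw [ae_restrict_iff' measurableSet_Ioi] at h
  filter_upwards [h] with r hr hrs
  rw [Set.uIoc_of_le hts] at hrs
  exact hr (ht.trans_lt hrs.1)

theorem lipschitzWith_primitive {q : ℝ → F} (hq : MemLp q ⊤ volume) :
    LipschitzWith (eLpNorm q ⊤ volume).toNNReal fun t => ∫ r in (0 : ℝ)..t, q r := by
  refine LipschitzWith.of_dist_le_mul fun s t => ?_
  rw [dist_eq_norm, intervalIntegral.integral_interval_sub_left
    (intervalIntegrable_of_memLp_top hq _ _) (intervalIntegrable_of_memLp_top hq _ _),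
    Real.dist_eq]
  apply intervalIntegral.norm_integral_le_of_norm_le_const_ae
  filter_upwards [ae_nnnorm_le_of_memLp_top hq] with r hr _ using hr

end EssentiallyBoundedInputs

/-! ### Solutions of equations with additive input -/

section AdditiveInputs

variable {E : Type*} [NormedAddCommGroup E] [NormedSpace ℝ E]
  {Φ : E → E} {q : ℝ → E} {x : ℝ → E} {τ : ℝ}

theorem exists_isSolutionOn_add [FiniteDimensional ℝ E] (hΦ : Continuous Φ) {C : ℝ} (hC : 0 ≤ C)
    (hgrowth : ∀ x, ‖Φ x‖ ≤ C * (1 + ‖x‖)) (hq : MemLp q ⊤ volume) (x₀ : E) :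
    ∃ x : ℝ → E, x 0 = x₀ ∧ ∀ τ, 0 ≤ τ → IsSolutionOn (fun e p => Φ e + p) q x τ := by
  obtain ⟨x, hxc, hx⟩ := exists_forward_solution hΦ hC hgrowth (lipschitzWith_primitive hq)
    intervalIntegral.integral_same x₀
  have hx0 : x 0 = x₀ := by simpa using hx 0 le_rfl
  have hint : ∀ t, 0 ≤ t → IntervalIntegrable (fun s => Φ (x s)) volume 0 t := fun t ht => by
    refine ContinuousOn.intervalIntegrable ?_
    rw [Set.uIcc_of_le ht]
    exact hΦ.comp_continuousOn (hxc t)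
  refine ⟨x, hx0, fun τ hτ => ⟨(hint τ hτ).add (intervalIntegrable_of_memLp_top hq _ _),
    fun t ht => ?_⟩⟩
  rw [intervalIntegral.integral_add (hint t ht.1) (intervalIntegrable_of_memLp_top hq _ _),
    hx t ht.1, hx0]
  abel

theorem IsSolutionOn.continuousOn {F : Type*} [NormedAddCommGroup F] {f : E → F → E} {p : ℝ → F}
    (hτ : 0 ≤ τ) (h : IsSolutionOn f p x τ) : ContinuousOn x (Set.Icc 0 τ) := by
  have h1 := intervalIntegral.continuousOn_primitive_interval' h.1 Set.left_mem_uIcc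
  rw [Set.uIcc_of_le hτ] at h1
  exact (continuousOn_const.add h1).congr h.2

theorem IsSolutionOn.hasDerivWithinAt_sub [CompleteSpace E] (hΦ : Continuous Φ)
    (hq : MemLp q ⊤ volume) (hτ : 0 ≤ τ) (h : IsSolutionOn (fun e p => Φ e + p) q x τ)
    {t : ℝ} (ht : t ∈ Set.Ico 0 τ) :
    HasDerivWithinAt (fun s => x s - ∫ r in (0 : ℝ)..s, q r) (Φ (x t)) (Set.Ioi t) t := by
  have hxc := h.continuousOn hτ
  -- Clamping time to [0, τ] gives a globally continuous path, to which the fundamental theorem of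
  -- calculus applies even at the endpoint 0.
  set y : ℝ → E := fun s => x (max 0 (min s τ)) with hy
  have hyc : Continuous y := hxc.comp_continuous (by fun_prop) fun s =>
    ⟨le_max_left _ _, max_le hτ (min_le_right _ _)⟩
  have hyx : ∀ s ∈ Set.Icc 0 τ, y s = x s := fun s hs => by
    simp only [hy]
    rw [min_eq_left hs.2, max_eq_right hs.1]
  have hd : HasDerivAt (fun s => x 0 + ∫ r in (0 : ℝ)..s, Φ (y r)) (Φ (y t)) t :=
    ((hΦ.comp hyc).integral_hasStrictDerivAt 0 t).hasDerivAt.const_add _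
  have heq : ∀ s ∈ Set.Icc 0 τ, x s - ∫ r in (0 : ℝ)..s, q r
      = x 0 + ∫ r in (0 : ℝ)..s, Φ (y r) := by
    intro s hs
    have hint : IntervalIntegrable (fun r => Φ (y r)) volume 0 s :=
      (hΦ.comp hyc).intervalIntegrable _ _
    have hc : ∫ r in (0 : ℝ)..s, (Φ (x r) + q r) = ∫ r in (0 : ℝ)..s, (Φ (y r) + q r) := by
      apply intervalIntegral.integral_congr
      intro r hr
      rw [Set.uIcc_of_le hs.1] at hr
      simp only [hyx r ⟨hr.1, hr.2.trans hs.2⟩]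
    rw [h.2 s hs, hc, intervalIntegral.integral_add hint (intervalIntegrable_of_memLp_top hq _ _)]
    abel
  rw [← hyx t ⟨ht.1, ht.2.le⟩]
  refine hd.hasDerivWithinAt.congr_of_eventuallyEq ?_ (heq t ⟨ht.1, ht.2.le⟩)
  filter_upwards [Ioc_mem_nhdsGT ht.2] with s hs
  exact heq s ⟨ht.1.trans hs.1.le, hs.2⟩

end AdditiveInputs

/-! ### Assembly of the stability estimate -/

section InputToState

variable {N n : ℕ} {μ : ℝ} {X : Matrix (Fin n) (Fin n) ℝ} {Y : Matrix (Fin 1) (Fin n) ℝ}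

theorem isISS_errorField (hμ : μ ∈ Set.Ioo (-1 : ℝ) 0) (hX : X.PosDef)
    (hGX : (generator n μ * X + X * generator n μ).PosDef)
    (hLMI : (-(chainA n * X + X * (chainA n)ᵀ - chainB n * Y - Yᵀ * (chainB n)ᵀ)).PosDef) :
    IsISS (errorField μ X Y :
      (Fin N → Fin n → ℝ) → (Fin N → Fin n → ℝ) → Fin N → Fin n → ℝ) := by
  have hd := isHomData_chain hμ hX hGX
  have hκ : 0 < -μ := neg_pos.2 hμ.2
  have hμ1 : 0 < 1 + μ := by linarith [hμ.1]
  have hF : Continuous (loopField μ X Y) := continuous_loopField hd hμ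
  have hΦ : Continuous fun (e : Fin N → Fin n → ℝ) i => loopField μ X Y (e i) := by fun_prop
  have hfield : (errorField μ X Y :
      (Fin N → Fin n → ℝ) → (Fin N → Fin n → ℝ) → Fin N → Fin n → ℝ)
      = fun e p => (fun i => loopField μ X Y (e i)) + p := rfl
  refine ⟨fun x₀ q hq => ?_, ?_⟩
  · obtain ⟨C, hC, hg⟩ := exists_loopField_growth (Y := Y) hμ hd
    rw [hfield]
    refine exists_isSolutionOn_add hΦ hC (fun e => ?_) hq x₀
    rw [pi_norm_le_iff_of_nonneg (by positivity)]
    intro i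
    refine (hg (e i)).trans ?_
    gcongr
    exact norm_le_pi_norm e i
  obtain ⟨c, D, hc, hD, hest⟩ := exists_block_estimate hμ hX hGX hLMI
  obtain ⟨V, hV0, hV⟩ := hd.exists_homNorm_le (chainWeight_le hμ)
  obtain ⟨M, hM0, hM⟩ := hd.exists_norm_le (chainWeight_le hμ)
  lift D to ℝ≥0 using hD.le
  lift V to ℝ≥0 using hV0.le
  lift M to ℝ≥0 using hM0.le
  rw [NNReal.coe_pos] at hD hV0 hM0
  have hR : 0 < (n : ℝ) + 1 := by positivity
  -- `W` bounds V^{-μ} at time 0 in terms of the initial norm, `θ` solves the threshold condition of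
  -- the block estimate with equality, and `η` converts a bound on V^{-μ} back into one on the norm.
  set W : ℝ≥0 → ℝ≥0 := fun s => (V * s + (V * s) ^ (1 / ((n : ℝ) + 1))) ^ (-μ) with hWdef
  have hW : IsClassK W := (isClassK_rpow hκ).comp ((isClassK_const_mul hV0).add
    ((isClassK_rpow (one_div_pos.2 hR)).comp (isClassK_const_mul hV0)))
  set θ : ℝ≥0 → ℝ≥0 := fun δ =>
    ((D * δ) ^ (1 / (1 + μ)) + (D * δ) ^ (1 / ((n : ℝ) + 1))) ^ (-μ) with hθdef
  have hθ : IsClassK θ := (isClassK_rpow hκ).comp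
    (((isClassK_rpow (one_div_pos.2 hμ1)).comp (isClassK_const_mul hD)).add
      ((isClassK_rpow (one_div_pos.2 hR)).comp (isClassK_const_mul hD)))
  set η : ℝ≥0 → ℝ≥0 := fun w =>
    M * (w ^ (1 / -μ) + (w ^ (1 / -μ)) ^ ((n : ℝ) + 1)) with hηdef
  have hη : IsClassK η := (isClassK_const_mul hM0).comp ((isClassK_rpow (one_div_pos.2 hκ)).add
    ((isClassK_rpow hR).comp (isClassK_rpow (one_div_pos.2 hκ))))
  have hη2 : IsClassK fun w => η (2 * w) := hη.comp (isClassK_const_mul two_pos)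
  have hroot : ∀ y : ℝ≥0, (y ^ (-μ)) ^ (1 / -μ) = y := fun y => by
    rw [← NNReal.rpow_mul, mul_one_div_cancel hκ.ne', NNReal.rpow_one]
  refine ⟨fun s t => η (2 * decay c (W s) t), fun δ => η (2 * θ δ),
    (isClassKL_decay hc).comp hη2 hW, hη2.comp hθ, fun q hq τ x hτ hx t ht => ?_⟩
  -- A strictly larger δ keeps θ(δ), hence the level, positive even for zero input. Continuity then
  -- lets δ decrease to `inputNorm q`.
  have key : ∀ δ, inputNorm q < δ →
      ‖x t‖₊ ≤ η (2 * decay c (W ‖x 0‖₊) t.toNNReal) + η (2 * θ δ) := by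
    intro δ hδ
    refine le_trans ?_ (hη.map_add_le _ _)
    rw [pi_nnnorm_le_iff]
    intro i
    have hδ0 : 0 < δ := pos_of_gt hδ
    have hxc := hx.continuousOn hτ
    have hderiv : ∀ t ∈ Set.Ico 0 τ, HasDerivWithinAt
        (fun s => x s i - (∫ r in (0 : ℝ)..s, q r) i) (loopField μ X Y (x t i)) (Set.Ioi t) t :=
      fun t ht => (hasDerivWithinAt_pi.1
        (IsSolutionOn.hasDerivWithinAt_sub hΦ hq hτ (hfield ▸ hx) ht)) i
    have hQ : ∀ t s, 0 ≤ t → t ≤ s →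
        ‖(∫ r in (0 : ℝ)..s, q r) i - (∫ r in (0 : ℝ)..t, q r) i‖ ≤ δ * (s - t) := by
      intro t s ht hts
      refine (norm_le_pi_norm ((∫ r in (0 : ℝ)..s, q r) - ∫ r in (0 : ℝ)..t, q r) i).trans ?_
      refine (norm_integral_sub_le_inputNorm hq ht hts).trans ?_
      have : (inputNorm q : ℝ) ≤ δ := hδ.le
      have := sub_nonneg.2 hts
      gcongr
    have hθroot : ((D : ℝ) * δ) ^ (1 / (1 + μ)) + ((D : ℝ) * δ) ^ (1 / ((n : ℝ) + 1))
        ≤ (θ δ : ℝ) ^ (1 / -μ) := by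
      have := congrArg NNReal.toReal
        (hroot ((D * δ) ^ (1 / (1 + μ)) + (D * δ) ^ (1 / ((n : ℝ) + 1))))
      push_cast at this
      simp only [hθdef]
      push_cast
      exact this.ge
    have hinit : homNorm (generator n μ) X⁻¹ (x 0 i)
        ≤ ((W ‖x 0‖₊ : ℝ) + θ δ) ^ (1 / -μ) := by
      have h1 := congrArg NNReal.toReal
        (hroot (V * ‖x 0‖₊ + (V * ‖x 0‖₊) ^ (1 / ((n : ℝ) + 1))))
      calc homNorm (generator n μ) X⁻¹ (x 0 i)
          ≤ V * ‖x 0 i‖ + (V * ‖x 0 i‖) ^ (1 / ((n : ℝ) + 1)) := hV _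
        _ ≤ V * ‖x 0‖ + (V * ‖x 0‖) ^ (1 / ((n : ℝ) + 1)) := by
          have := norm_le_pi_norm (x 0) i
          gcongr
        _ = (W ‖x 0‖₊ : ℝ) ^ (1 / -μ) := by
          simp only [hWdef]
          push_cast at h1 ⊢
          exact h1.symm
        _ ≤ _ := by
          gcongr
          exact le_add_of_nonneg_right (θ δ).2
    have h := hest (fun s => x s i) (fun s => (∫ r in (0 : ℝ)..s, q r) i) τ δ (W ‖x 0‖₊) (θ δ)
      ((continuous_apply i).comp_continuousOn hxc) hderiv hQ δ.2 (W ‖x 0‖₊).2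
      (NNReal.coe_pos.2 (hθ.pos hδ0)) hθroot hinit t ht
    have hlevel : levelPow c (W ‖x 0‖₊) (θ δ) t
        = ((decay c (W ‖x 0‖₊) t.toNNReal + θ δ : ℝ≥0) : ℝ) := by
      rw [levelPow, NNReal.coe_add, coe_decay, Real.coe_toNNReal _ ht.1]
    have hpos : 0 < ((decay c (W ‖x 0‖₊) t.toNNReal + θ δ : ℝ≥0) : ℝ) :=
      NNReal.coe_pos.2 (add_pos_of_nonneg_of_pos zero_le (hθ.pos hδ0))
    have h2 := hM _ _ h
    rw [hlevel, mul_comm (1 / -μ), ← Real.rpow_def_of_pos hpos] at h2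
    rw [← NNReal.coe_le_coe, coe_nnnorm]
    simp only [hηdef]
    push_cast at h2 ⊢
    exact h2
  have hcont : Continuous fun δ => η (2 * decay c (W ‖x 0‖₊) t.toNNReal) + η (2 * θ δ) :=
    continuous_const.add (hη2.comp hθ).continuous
  refine ge_of_tendsto ((hcont.tendsto (inputNorm q)).mono_left
    (nhdsWithin_le_nhds (s := Set.Ioi (inputNorm q)))) ?_
  filter_upwards [self_mem_nhdsWithin] with δ hδ using key δ hδ

end InputToState

end HomConsensus

theorem corollary1 (N n : ℕ) (hN : 1 ≤ N) (hn : 1 ≤ n)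
    (G : HomConsensus.LeaderGraph N)
    (μ : ℝ) (hμ : μ ∈ Set.Ioo (-1 : ℝ) 0)
    (X : Matrix (Fin n) (Fin n) ℝ) (Y : Matrix (Fin 1) (Fin n) ℝ)
    (hX : X.PosDef)
    (hGX : (HomConsensus.generator n μ * X + X * HomConsensus.generator n μ).PosDef)
    (hLMI : (-(HomConsensus.chainA n * X + X * (HomConsensus.chainA n)ᵀ
      - HomConsensus.chainB n * Y - Yᵀ * (HomConsensus.chainB n)ᵀ)).PosDef) :
    -- the perturbed error equation is input-to-state stable
    HomConsensus.IsISS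
      (HomConsensus.errorField μ X Y :
        (Fin N → Fin n → ℝ) → (Fin N → Fin n → ℝ) → Fin N → Fin n → ℝ) ∧
    -- the extended field `(e, q) ↦ (f(e, q), 0)` is homogeneous of degree `μ`
    HomConsensus.IsHomogeneousField (HomConsensus.extDil μ) μ
      (fun p : (Fin N → Fin n → ℝ) × (Fin N → Fin n → ℝ) =>
        (HomConsensus.errorField μ X Y p.1 p.2, 0)) ∧
    -- the consensus error of the disturbed closed-loop system obeys the error equation
    (∀ (q : ℝ → Fin (N + 1) → Fin n → ℝ), MemLp q ⊤ volume →
      ∀ (τ : ℝ) (x : ℝ → Fin (N + 1) → Fin n → ℝ), 0 ≤ τ →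
        HomConsensus.IsClosedLoop G μ X Y q x τ →
        HomConsensus.IsSolutionOn (HomConsensus.errorField μ X Y)
          (fun t (i : Fin N) => q t i.succ - q t 0) (fun t i => x t i.succ - x t 0) τ) := by
  exact ⟨HomConsensus.isISS_errorField hμ hX hGX hLMI,
    HomConsensus.isHomogeneousField_errorField hμ (HomConsensus.isHomData_chain hμ hX hGX),
    fun _ _ _ _ hτ h => h.isSolutionOn_error hτ⟩
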